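/- Every MV-algebra $(E;\oplus,{}^*,0,1)$ is regarded as an effect algebra: $a+b$ is defined iff $a\le b^*$, and then $a+b=a\oplus b$. For an MV-algebra $E$ the following three statements are equivalent. (i) $E$ is local (it has a unique maximal ideal) and its radical $\mathrm{Rad}(E)$, the intersection of all maximal ideals, is retractive. (ii) There is a subgroup $\mathbb{H}$ of $\mathbb{R}$ with $1\in\mathbb{H}$ such that $E$ is strong $(\mathbb{H},1)$-perfect. (iii) There are a subgroup $\mathbb{H}$ of $\mathbb{R}$ with $1\in\mathbb{H}$ and an Abelian $\ell$-group $G$ such that $E\cong\Gamma(\mathbb{H}\overrightarrow{\times}G,(1,0))$ as effect algebras. Here the following terms are used. *Homomorphisms.* A homomorphism of effect algebras is a map that preserves $1$ and every sum that is defined; an isomorphism is a bijection that is a homomorphism in both directions. Further, $a\le b$ means that $a+c=b$ for some $c$, we then write $c=b-a$, and $a^-=1-a$. *Ideals.* An ideal of $E$ is a nonempty subset that is closed downwards and closed under the sums that are defined. A maximal ideal is an ideal $I\ne E$ that is not properly contained in an ideal $J\neq E$. For an ideal $I$, the quotient $E/I$ is taken by the relation $a\sim_I b$ iff $a-e=b-f$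 for some $e,f\in I$ with $e\le a$, $f\le b$; the sum of two classes is defined iff they have representatives whose sum is defined, and it is then the class of that sum. The ideal $I$ is retractive if there is a homomorphism $\delta:E/I\to E$ with $\pi_I\circ\delta=\mathrm{id}_{E/I}$, where $\pi_I:E\to E/I$ is the projection. *Strong perfectness.* An effect algebra $E$ is strong $(\mathbb{H},1)$-perfect if the following two conditions hold. 1. $E$ has the Riesz Decomposition Property: whenever $a_1+a_2=b_1+b_2$ in $E$, there are $c_{11},c_{12},c_{21},c_{22}\in E$ with $a_1=c_{11}+c_{12}$, $a_2=c_{21}+c_{22}$, $b_1=c_{11}+c_{21}$, $b_2=c_{12}+c_{22}$. 2. With $[0,1]_{\mathbb{H}}=\{h\in\mathbb{H}:0\le h\le1\}$, there are a partition $(E_t: t\in[0,1]_{\mathbb{H}})$ of $E$ into nonempty sets and elements $c_t\in E_t$ such that - $\{x^-:x\in E_t\}=E_{1-t}$ for all $t$; - if $x\in E_s$, $y\in E_t$ and $x+y$ is defined, then $s+t\le1$ and $x+y\in E_{s+t}$; - if $s<t$, then $x\le y$ for all $x\in E_s$, $y\in E_t$; - every $E_t$ is upwards and downwards directed; - $c_s+c_t$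 is defined and equals $c_{s+t}$ whenever $s+t\le1$; - $c_1=1$. *Intervals.* $\mathbb{H}\overrightarrow{\times}G$ is the group $\mathbb{H}\times G$ with the lexicographic order: $(h,g)\le(h',g')$ iff $h<h'$, or $h=h'$ and $g\le g'$. For an Abelian po-group $K$ and $u\ge0$ in $K$, $\Gamma(K,u)$ is the effect algebra on $\{k\in K:0\le k\le u\}$ in which $a+b$ is defined iff $a\le u-b$, and is then the sum in $K$. -/

import Mathlib

/-! ### Effect algebras -/

/-- A set with constants `0`, `1` and a partial binary operation `+`, the latter given by its graph:
`IsSum a b c` means that `a + b` is defined and equals `c`. -/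
class PartialSumAlgebra (E : Type*) extends Zero E, One E where
  IsSum : E → E → E → Prop

/-- An effect algebra. The existential statements express that sums are defined. -/
class EffectAlgebra (E : Type*) extends PartialSumAlgebra E where
  isSum_unique : ∀ {a b c d : E}, IsSum a b c → IsSum a b d → c = d
  isSum_comm : ∀ {a b c : E}, IsSum a b c ↔ IsSum b a c
  isSum_assoc : ∀ {a b c e : E},
    (∃ d, IsSum a b d ∧ IsSum d c e) ↔ (∃ f, IsSum b c f ∧ IsSum a f e)
  exists_unique_compl : ∀ a : E, ∃! b : E, IsSum a b 1
  eq_zero_of_isSum_one : ∀ {a b : E}, IsSum a 1 b → a = 0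

namespace EffectAlgebra

open PartialSumAlgebra

/-- The element `a⁻`, the unique one with `a + a⁻ = 1`. -/
noncomputable def compl {E : Type*} [EffectAlgebra E] (a : E) : E :=
  (exists_unique_compl a).choose

/-- The order: `a ≤ b` iff `a + c = b` for some `c`. -/
def ELe {E : Type*} [PartialSumAlgebra E] (a b : E) : Prop := ∃ c, IsSum a c b

/-- The Riesz Decomposition Property. -/
def RDP (E : Type*) [PartialSumAlgebra E] : Prop :=
  ∀ a₁ a₂ b₁ b₂ s : E, IsSum a₁ a₂ s → IsSum b₁ b₂ s →
    ∃ c₁₁ c₁₂ c₂₁ c₂₂ : E, IsSum c₁₁ c₁₂ a₁ ∧ IsSum c₂₁ c₂₂ a₂ ∧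
      IsSum c₁₁ c₂₁ b₁ ∧ IsSum c₁₂ c₂₂ b₂

/-- Homomorphisms: `1` is preserved and so is every sum that is defined. -/
structure IsHom {E F : Type*} [PartialSumAlgebra E] [PartialSumAlgebra F] (h : E → F) : Prop where
  map_one : h 1 = 1
  map_isSum : ∀ {a b c : E}, IsSum a b c → IsSum (h a) (h b) (h c)

/-- `E ≅ F`: there is a bijection that is a homomorphism in both directions. -/
def Isomorphic (E F : Type*) [PartialSumAlgebra E] [PartialSumAlgebra F] : Prop :=
  ∃ e : E ≃ F, IsHom e ∧ IsHom e.symm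

/-! ### Ideals, radical, quotients -/

structure IsIdeal {E : Type*} [PartialSumAlgebra E] (I : Set E) : Prop where
  nonempty : I.Nonempty
  mem_of_le : ∀ {a b : E}, ELe a b → b ∈ I → a ∈ I
  mem_of_isSum : ∀ {a b c : E}, a ∈ I → b ∈ I → IsSum a b c → c ∈ I

structure IsMaximalIdeal {E : Type*} [PartialSumAlgebra E] (I : Set E) : Prop where
  isIdeal : IsIdeal I
  ne_univ : I ≠ Set.univ
  eq_of_subset : ∀ J : Set E, IsIdeal J → J ≠ Set.univ → I ⊆ J → I = J

/-- `E` is local if it has a unique maximal ideal. -/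
def IsLocal (E : Type*) [PartialSumAlgebra E] : Prop := ∃! I : Set E, IsMaximalIdeal I

/-- The radical, the intersection of all maximal ideals. -/
def Rad (E : Type*) [PartialSumAlgebra E] : Set E := ⋂₀ {I | IsMaximalIdeal I}

/-- `a ∼ b` modulo `I`: `a - e = b - f` for some `e, f ∈ I` with `e ≤ a` and `f ≤ b`
(the common difference is `d`). -/
def IdealRel {E : Type*} [PartialSumAlgebra E] (I : Set E) (a b : E) : Prop :=
  ∃ e ∈ I, ∃ f ∈ I, ∃ d, IsSum e d a ∧ IsSum f d b

theorem isSum_zero_left {E : Type*} [EffectAlgebra E] (a : E) : IsSum 0 a a := by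
  obtain ⟨b, hb, hb'⟩ := exists_unique_compl a
  obtain ⟨z, hz, -⟩ := exists_unique_compl (1 : E)
  have hz0 : z = 0 := eq_zero_of_isSum_one (isSum_comm.1 hz)
  subst hz0
  obtain ⟨f, hf, hf'⟩ := isSum_assoc.1 ⟨1, hb, hz⟩
  obtain rfl : f = b := hb' f hf'
  obtain ⟨c, -, hc'⟩ := exists_unique_compl f
  obtain ⟨d, hd, hd'⟩ := isSum_assoc.2 ⟨f, isSum_comm.1 hf, hf'⟩
  have h₁ : a = c := hc' a (isSum_comm.1 hf')
  have h₂ : d = c := hc' d (isSum_comm.1 hd')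
  rw [← h₁] at h₂
  exact isSum_comm.1 (h₂ ▸ hd)

/-- For an ideal of an effect algebra with the RDP, `IdealRel` is an equivalence relation. -/
theorem idealRel_equivalence {E : Type*} [EffectAlgebra E] (hE : RDP E) {I : Set E}
    (hI : IsIdeal I) : Equivalence (IdealRel I) := by
  have h0 : (0 : E) ∈ I := by
    obtain ⟨x, hx⟩ := hI.nonempty
    exact hI.mem_of_le ⟨x, isSum_zero_left x⟩ hx
  refine ⟨fun a => ⟨0, h0, 0, h0, a, isSum_zero_left a, isSum_zero_left a⟩, ?_, ?_⟩
  · rintro a b ⟨e, he, f, hf, d, h₁, h₂⟩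
    exact ⟨f, hf, e, he, d, h₂, h₁⟩
  · rintro a b c ⟨e, he, f, hf, d, h₁, h₂⟩ ⟨g, hg, k, hk, d', h₃, h₄⟩
    obtain ⟨p, q, r, s, hpq, hrs, hpr, hqs⟩ := hE f d g d' b h₂ h₃
    obtain ⟨x, hx, hx'⟩ := isSum_assoc.2 ⟨d, hrs, h₁⟩
    obtain ⟨y, hy, hy'⟩ := isSum_assoc.2 ⟨d', hqs, h₄⟩
    exact ⟨x, hI.mem_of_isSum he (hI.mem_of_le ⟨p, isSum_comm.1 hpr⟩ hg) hx,
      y, hI.mem_of_isSum hk (hI.mem_of_le ⟨p, isSum_comm.1 hpq⟩ hf) hy, s, hx', hy'⟩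

/-- The quotient `E/I`. If `E` has the RDP and `I` is an ideal, then `IdealRel I` is an
equivalence relation (`idealRel_equivalence`), so that `Quot` adds no identifications. -/
def IdealQuot {E : Type*} [PartialSumAlgebra E] (I : Set E) : Type _ := Quot (IdealRel I)

/-- The canonical projection `E → E/I`. -/
def IdealQuot.mk {E : Type*} [PartialSumAlgebra E] (I : Set E) (a : E) : IdealQuot I :=
  Quot.mk (IdealRel I) a

/-- The quotient structure: `x + y` is defined in `E/I` iff there are representatives `a`, `b`
of `x`, `y` for which `a + b` is defined in `E`, and then `x + y` is the class of `a + b`. -/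
instance IdealQuot.instPartialSumAlgebra {E : Type*} [PartialSumAlgebra E] (I : Set E) :
    PartialSumAlgebra (IdealQuot I) where
  zero := IdealQuot.mk I 0
  one := IdealQuot.mk I 1
  IsSum x y z := ∃ a b c : E, IsSum a b c ∧
    IdealQuot.mk I a = x ∧ IdealQuot.mk I b = y ∧ IdealQuot.mk I c = z

/-- The ideal `I` is retractive: the projection `E → E/I` has a right inverse homomorphism. -/
def IsRetractive {E : Type*} [PartialSumAlgebra E] (I : Set E) : Prop :=
  ∃ δ : IdealQuot I → E, IsHom δ ∧ ∀ x, IdealQuot.mk I (δ x) = x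

end EffectAlgebra

/-! ### Intervals in Abelian po-groups -/

/-- The interval `Γ(G, u) = [0, u]` of a po-group `G`, where `u ≥ 0`. -/
def PoGamma {G : Type*} [AddCommGroup G] [PartialOrder G] (u : G) (_hu : 0 ≤ u) : Type _ :=
  {g : G // 0 ≤ g ∧ g ≤ u}

/-- The effect algebra `Γ(G, u)`: `a + b` is defined iff `a ≤ u - b`, and then it is the sum
in `G`. -/
instance PoGamma.instEffectAlgebra {G : Type*} [AddCommGroup G] [PartialOrder G]
    [IsOrderedAddMonoid G] (u : G) (hu : 0 ≤ u) : EffectAlgebra (PoGamma u hu) where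
  zero := ⟨0, le_rfl, hu⟩
  one := ⟨u, hu, le_rfl⟩
  IsSum a b c := a.1 ≤ u - b.1 ∧ c.1 = a.1 + b.1
  isSum_unique h₁ h₂ := Subtype.ext (h₁.2.trans h₂.2.symm)
  isSum_comm {a b c} := by
    rw [le_sub_iff_add_le, le_sub_iff_add_le, add_comm a.1 b.1]
  isSum_assoc {a b c e} := by
    constructor
    · rintro ⟨d, ⟨_, h₂⟩, h₃, h₄⟩
      have he : e.1 = a.1 + (b.1 + c.1) := by rw [h₄, h₂, add_assoc]
      have hbc : b.1 + c.1 ≤ u := le_trans (by rw [he]; exact le_add_of_nonneg_left a.2.1) e.2.2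
      refine ⟨⟨b.1 + c.1, add_nonneg b.2.1 c.2.1, hbc⟩, ⟨le_sub_iff_add_le.2 hbc, rfl⟩, ?_, he⟩
      exact le_sub_iff_add_le.2 (he ▸ e.2.2)
    · rintro ⟨d, ⟨_, h₂⟩, h₃, h₄⟩
      have he : e.1 = (a.1 + b.1) + c.1 := by rw [h₄, h₂, add_assoc]
      have hab : a.1 + b.1 ≤ u := le_trans (by rw [he]; exact le_add_of_nonneg_right c.2.1) e.2.2
      refine ⟨⟨a.1 + b.1, add_nonneg a.2.1 b.2.1, hab⟩, ⟨le_sub_iff_add_le.2 hab, rfl⟩, ?_, he⟩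
      exact le_sub_iff_add_le.2 (he ▸ e.2.2)
  exists_unique_compl a := by
    refine ⟨⟨u - a.1, sub_nonneg.2 a.2.2, sub_le_self u a.2.1⟩, ⟨?_, ?_⟩, ?_⟩
    · exact (sub_sub_cancel u a.1).ge
    · exact (add_sub_cancel a.1 u).symm
    · rintro b ⟨_, h⟩
      exact Subtype.ext (eq_sub_of_add_eq' h.symm)
  eq_zero_of_isSum_one {a b} h := by
    have h₁ : a.1 ≤ u - u := h.1
    rw [sub_self] at h₁
    exact Subtype.ext (le_antisymm h₁ a.2.1)

/-! ### Decompositions indexed by `[0, u]_H` -/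

namespace EffectAlgebra

open PartialSumAlgebra

/-- `(D t : t ∈ [0, u]_H)` is an `(H, u)`-decomposition of `E`: the `D t` are nonempty, pairwise
disjoint and cover `E`, `(D t)⁻ = D (u - t)`, and if `x ∈ D s`, `y ∈ D t` and `x + y` exists, then
`s + t ≤ u` and `x + y ∈ D (s + t)`. The notion is meant for a nontrivial unital po-group `(H, u)`;
a subgroup of `ℝ` with unit `1` always is one. -/
structure IsDecomposition (E : Type*) [EffectAlgebra E] {H : Type*} [AddCommGroup H]
    [PartialOrder H] [IsOrderedAddMonoid H] (u : H) (hu : 0 ≤ u)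
    (D : PoGamma u hu → Set E) : Prop where
  nonempty : ∀ t, (D t).Nonempty
  disjoint : ∀ s t, s ≠ t → D s ∩ D t = ∅
  iUnion_eq : ⋃ t, D t = Set.univ
  compl_image : ∀ t r : PoGamma u hu, r.1 = u - t.1 → compl '' D t = D r
  add_mem : ∀ (s t : PoGamma u hu) (x y z : E), x ∈ D s → y ∈ D t → IsSum x y z →
    s.1 + t.1 ≤ u ∧ ∃ r : PoGamma u hu, r.1 = s.1 + t.1 ∧ z ∈ D r

/-- The decomposition is ordered: `D s ≤ D t` elementwise whenever `s < t`. -/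
def IsOrderedDecomposition {E : Type*} [EffectAlgebra E] {H : Type*} [AddCommGroup H]
    [PartialOrder H] [IsOrderedAddMonoid H] (u : H) (hu : 0 ≤ u)
    (D : PoGamma u hu → Set E) : Prop :=
  ∀ s t : PoGamma u hu, s.1 < t.1 → ∀ x ∈ D s, ∀ y ∈ D t, ELe x y

/-- The decomposition is directed: every `D t` is upwards and downwards directed. -/
def IsDirectedDecomposition {E : Type*} [EffectAlgebra E] {H : Type*} [AddCommGroup H]
    [PartialOrder H] [IsOrderedAddMonoid H] (u : H) (hu : 0 ≤ u)
    (D : PoGamma u hu → Set E) : Prop :=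
  ∀ t, (∀ x ∈ D t, ∀ y ∈ D t, ∃ z ∈ D t, ELe x z ∧ ELe y z) ∧
    (∀ x ∈ D t, ∀ y ∈ D t, ∃ z ∈ D t, ELe z x ∧ ELe z y)

/-- `E` has the RDP and is strong `(H, u)`-perfect: it has an ordered and directed
`(H, u)`-decomposition `(D t)` and elements `c t ∈ D t` with `c (v + t) = c v + c t` whenever
`v + t ≤ u`, and `c u = 1`. -/
def IsStrongPerfect (E : Type*) [EffectAlgebra E] {H : Type*} [AddCommGroup H]
    [PartialOrder H] [IsOrderedAddMonoid H] (u : H) (hu : 0 ≤ u) : Prop :=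
  RDP E ∧ ∃ D : PoGamma u hu → Set E,
    IsDecomposition E u hu D ∧ IsOrderedDecomposition u hu D ∧ IsDirectedDecomposition u hu D ∧
    ∃ c : PoGamma u hu → E, (∀ t, c t ∈ D t) ∧
      (∀ v t r : PoGamma u hu, r.1 = v.1 + t.1 → IsSum (c v) (c t) (c r)) ∧
      c 1 = 1

end EffectAlgebra

/-! ### MV-algebras -/

/-- An MV-algebra `(M; ⊕, *, 0, 1)`. -/
class MVAlgebra (M : Type*) extends Zero M, One M where
  oplus : M → M → M
  neg : M → M
  oplus_assoc : ∀ x y z : M, oplus (oplus x y) z = oplus x (oplus y z)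
  oplus_comm : ∀ x y : M, oplus x y = oplus y x
  oplus_zero : ∀ x : M, oplus x 0 = x
  neg_neg : ∀ x : M, neg (neg x) = x
  oplus_one : ∀ x : M, oplus x 1 = 1
  one_eq : (1 : M) = neg 0
  oplus_neg_swap : ∀ x y : M,
    oplus x (neg (oplus x (neg y))) = oplus y (neg (oplus y (neg x)))

namespace MVAlgebra

variable {M : Type*} [MVAlgebra M]

/-- The natural order of an MV-algebra: `x ≤ y` iff `x* ⊕ y = 1`. -/
def MLe (x y : M) : Prop := oplus (neg x) y = 1

theorem neg_one : neg (1 : M) = 0 := by rw [one_eq, neg_neg]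

theorem oplus_neg_self (x : M) : oplus x (neg x) = 1 := by
  have h := oplus_neg_swap x (1 : M)
  rwa [neg_one, oplus_zero, oplus_comm (1 : M), oplus_one] at h

theorem mle_iff (x y : M) : MLe x y ↔ ∃ w, y = oplus x w := by
  constructor
  · intro h
    have h' := oplus_neg_swap x y
    rw [oplus_comm y (neg x), show oplus (neg x) y = 1 from h, neg_one, oplus_zero] at h'
    exact ⟨_, h'.symm⟩
  · rintro ⟨w, rfl⟩
    show oplus (neg x) (oplus x w) = 1
    rw [← oplus_assoc, oplus_comm (neg x) x, oplus_neg_self, oplus_comm, oplus_one]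

theorem mle_neg_comm {a b : M} (h : MLe a (neg b)) : MLe b (neg a) := by
  rw [MLe, oplus_comm]; exact h

theorem sum_assoc {a b c : M} (h₁ : MLe a (neg b)) (h₂ : MLe (oplus a b) (neg c)) :
    MLe b (neg c) ∧ MLe a (neg (oplus b c)) := by
  constructor
  · obtain ⟨w, hw⟩ := (mle_iff _ _).1 h₂
    refine (mle_iff _ _).2 ⟨oplus a w, ?_⟩
    rw [hw, oplus_comm a b, oplus_assoc]
  · obtain ⟨v, hv⟩ := (mle_iff _ _).1 (mle_neg_comm h₂)
    refine mle_neg_comm ((mle_iff _ _).2 ⟨v, ?_⟩)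
    have h := oplus_neg_swap b (neg a)
    rw [neg_neg, show oplus (neg a) (neg b) = 1 from h₁, neg_one, oplus_zero, oplus_comm b a, hv]
      at h
    rw [oplus_assoc, h]

/-- The effect algebra of an MV-algebra: `a + b` is defined iff `a ≤ b*`, and then `a + b` is
`a ⊕ b`. -/
instance instEffectAlgebra {M : Type*} [MVAlgebra M] : EffectAlgebra M where
  IsSum a b c := MLe a (neg b) ∧ c = oplus a b
  isSum_unique h₁ h₂ := h₁.2.trans h₂.2.symm
  isSum_comm {a b c} := by
    rw [oplus_comm a b]
    exact ⟨fun h => ⟨mle_neg_comm h.1, h.2⟩, fun h => ⟨mle_neg_comm h.1, h.2⟩⟩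
  isSum_assoc {a b c e} := by
    constructor
    · rintro ⟨d, ⟨h₁, rfl⟩, h₂, rfl⟩
      have h := sum_assoc h₁ h₂
      exact ⟨_, ⟨h.1, rfl⟩, h.2, oplus_assoc a b c⟩
    · rintro ⟨d, ⟨h₁, rfl⟩, h₂, rfl⟩
      have h := sum_assoc (mle_neg_comm h₁) (by
        rw [oplus_comm c b]; exact mle_neg_comm h₂)
      refine ⟨_, ⟨mle_neg_comm h.1, rfl⟩, ?_, (oplus_assoc a b c).symm⟩
      rw [oplus_comm a b]
      exact mle_neg_comm h.2
  exists_unique_compl a := by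
    refine ⟨neg a, ⟨?_, (oplus_neg_self a).symm⟩, ?_⟩
    · rw [neg_neg, MLe, oplus_comm]; exact oplus_neg_self a
    · rintro b ⟨h₁, h₂⟩
      have h := oplus_neg_swap b (neg a)
      rwa [neg_neg, show oplus (neg a) (neg b) = 1 from h₁, oplus_comm b a, ← h₂, neg_one,
        oplus_zero, oplus_zero] at h
  eq_zero_of_isSum_one {a b} h := by
    have h₁ : oplus (neg a) (neg 1) = 1 := h.1
    rw [neg_one, oplus_zero] at h₁
    rw [← neg_neg a, h₁, neg_one]

end MVAlgebra

/-! ### The units `1 ∈ ℍ` and `(1, 0) ∈ ℍ ×ₗ G` -/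

theorem subgroup_one_nonneg (H : AddSubgroup ℝ) (h1 : (1 : ℝ) ∈ H) : (0 : H) ≤ ⟨1, h1⟩ :=
  zero_le_one' ℝ

theorem lex_unit_nonneg {H G : Type*} [AddCommGroup H] [PartialOrder H] [AddCommGroup G]
    [PartialOrder G] {u : H} (hu : 0 ≤ u) : (0 : H ×ₗ G) ≤ toLex (u, 0) := by
  rw [Prod.Lex.le_iff]
  rcases hu.eq_or_lt with h | h
  · exact Or.inr ⟨h, le_rfl⟩
  · exact Or.inl h

universe w

/-! The passage from (i) to (iii) goes through a splitting (`IsSplitting`): an additive map `s` onto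
`[0, u]` that determines the order between different fibres, together with an additive choice `c` of
one point in every fibre. The fibres of `s` are the classes of a strong perfect decomposition, and
conversely, so a splitting and (ii) carry the same data.

Let `I` be the unique maximal ideal. An element outside `I` has a multiple equal to `1`. Since `x ⊖
y` and `y ⊖ x` are disjoint, `y ≤ x` as soon as `x ⊖ y` is not in `I` (`ele_of_ominus_notMem`), so
the quotient by `I` is totally ordered and Archimedean. Counting copies of suitable elements, as in
Hölder's theorem, gives a real state (`exists_real_state`). On `E` its zero set is exactly `I`, its
values and the integers yield `ℍ`, and the retraction yields `c` (`exists_isSplitting_of_local`).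

Given a splitting, the elements of value `0` form a cancellative monoid with suprema, hence the
positive cone of an ℓ-group `G`. The map `x ↦ (s x, x - c x)`, with the difference computed over a
common lower bound of `x` and `c x`, is the lexicographic representation
(`exists_lex_isIntervalRep`).

In a lexicographic interval over an Archimedean group, an ideal containing an element of positive
first coordinate is everything. So the elements of first coordinate `0` form the only maximal ideal,
and `(t, g) ↦ (t, 0)` induces a retraction. -/

namespace EffectAlgebra

open PartialSumAlgebra

/-! ### Order, cancellation and ideals in effect algebras -/

section Basic

variable {E : Type*} [EffectAlgebra E] {a b c d a' b' c' : E}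

theorem isSum_zero_right (a : E) : IsSum a 0 a := isSum_comm.1 (isSum_zero_left a)

theorem isSum_compl (a : E) : IsSum a (compl a) 1 := (exists_unique_compl a).choose_spec.1

theorem eq_compl_of_isSum (h : IsSum a b 1) : b = compl a :=
  (exists_unique_compl a).choose_spec.2 b h

theorem compl_compl (a : E) : compl (compl a) = a :=
  (eq_compl_of_isSum (isSum_comm.1 (isSum_compl a))).symm

/-- Both `b` and `d` are the complement of `a + c⁻`. -/
theorem isSum_left_cancel (h : IsSum a b c) (h' : IsSum a d c) : b = d := by
  obtain ⟨f, hf, hbf⟩ := isSum_assoc.1 ⟨c, isSum_comm.1 h, isSum_compl c⟩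
  obtain ⟨g, hg, hdg⟩ := isSum_assoc.1 ⟨c, isSum_comm.1 h', isSum_compl c⟩
  obtain rfl := isSum_unique hf hg
  rw [eq_compl_of_isSum (isSum_comm.1 hbf), eq_compl_of_isSum (isSum_comm.1 hdg)]

theorem eq_of_isSum_zero (h : IsSum a 0 b) : a = b := isSum_unique (isSum_zero_right a) h

theorem right_eq_zero_of_isSum_zero (h : IsSum a b 0) : b = 0 := by
  obtain ⟨f, hf, -⟩ := isSum_assoc.1 ⟨0, h, isSum_zero_left 1⟩
  exact eq_zero_of_isSum_one hf

theorem left_eq_zero_of_isSum_zero (h : IsSum a b 0) : a = 0 :=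
  right_eq_zero_of_isSum_zero (isSum_comm.1 h)

theorem ele_of_isSum_left (h : IsSum a b c) : ELe a c := ⟨b, h⟩

theorem ele_of_isSum_right (h : IsSum a b c) : ELe b c := ⟨a, isSum_comm.1 h⟩

theorem ele_refl (a : E) : ELe a a := ⟨0, isSum_zero_right a⟩

theorem zero_ele (a : E) : ELe 0 a := ⟨a, isSum_zero_left a⟩

theorem ele_one (a : E) : ELe a 1 := ⟨_, isSum_compl a⟩

theorem ele_trans (h : ELe a b) (h' : ELe b c) : ELe a c := by
  obtain ⟨p, hp⟩ := h
  obtain ⟨q, hq⟩ := h'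
  obtain ⟨f, -, hf⟩ := isSum_assoc.1 ⟨b, hp, hq⟩
  exact ⟨f, hf⟩

theorem ele_antisymm (h : ELe a b) (h' : ELe b a) : a = b := by
  obtain ⟨p, hp⟩ := h
  obtain ⟨q, hq⟩ := h'
  obtain ⟨f, hf, haf⟩ := isSum_assoc.1 ⟨b, hp, hq⟩
  obtain rfl := isSum_left_cancel haf (isSum_zero_right a)
  obtain rfl := left_eq_zero_of_isSum_zero hf
  exact eq_of_isSum_zero hp

theorem eq_zero_of_ele_zero (h : ELe a 0) : a = 0 := ele_antisymm h (zero_ele a)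

theorem exists_isSum_iff : (∃ c, IsSum a b c) ↔ ELe a (compl b) := by
  constructor
  · rintro ⟨f, hf⟩
    obtain ⟨g, hg, hbg⟩ := isSum_assoc.1 ⟨f, isSum_comm.1 hf, isSum_compl f⟩
    exact ⟨compl f, eq_compl_of_isSum hbg ▸ hg⟩
  · rintro ⟨p, hp⟩
    obtain ⟨f, hf, -⟩ := isSum_assoc.1 ⟨_, isSum_comm.1 hp, isSum_comm.1 (isSum_compl b)⟩
    exact ⟨f, hf⟩

theorem compl_ele_compl (h : ELe a b) : ELe (compl b) (compl a) := by
  rw [← compl_compl b, ← exists_isSum_iff] at h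
  obtain ⟨c, hc⟩ := h
  exact exists_isSum_iff.1 ⟨c, isSum_comm.1 hc⟩

theorem exists_isSum_of_ele (h : ELe a a') (h' : IsSum a' b c) :
    ∃ d, IsSum a b d ∧ ELe d c := by
  obtain ⟨p, hp⟩ := h
  obtain ⟨f, hf, hpf⟩ := isSum_assoc.1 ⟨a', isSum_comm.1 hp, h'⟩
  exact ⟨f, hf, ele_of_isSum_right hpf⟩

theorem ele_of_isSum_ele_isSum (h : ELe c c') (h₁ : IsSum a b c) (h₂ : IsSum a b' c') :
    ELe b b' := by
  obtain ⟨r, hr⟩ := h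
  obtain ⟨f, hf, haf⟩ := isSum_assoc.1 ⟨c, h₁, hr⟩
  exact ⟨r, isSum_left_cancel haf h₂ ▸ hf⟩

theorem isSum_isSum_isSum_comm {x y z : E} (h₁ : IsSum a b x) (h₂ : IsSum c d y)
    (h : IsSum x y z) : ∃ p q, IsSum a c p ∧ IsSum b d q ∧ IsSum p q z := by
  obtain ⟨f, hf, haf⟩ := isSum_assoc.1 ⟨x, h₁, h⟩
  obtain ⟨q, hq, hcq⟩ := isSum_assoc.1 ⟨y, h₂, isSum_comm.1 hf⟩
  obtain ⟨p, hp, hpq⟩ := isSum_assoc.2 ⟨f, hcq, haf⟩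
  exact ⟨p, q, hp, isSum_comm.1 hq, hpq⟩

theorem IsIdeal.zero_mem {I : Set E} (hI : IsIdeal I) : (0 : E) ∈ I := by
  obtain ⟨x, hx⟩ := hI.nonempty
  exact hI.mem_of_le (zero_ele x) hx

theorem IsIdeal.eq_univ_iff {I : Set E} (hI : IsIdeal I) : I = Set.univ ↔ (1 : E) ∈ I :=
  ⟨fun h => h ▸ Set.mem_univ _, fun h =>
    Set.eq_univ_of_forall fun x => hI.mem_of_le (ele_one x) h⟩

theorem IsMaximalIdeal.rad_eq {I : Set E} (hI : IsMaximalIdeal I)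
    (h : ∀ J : Set E, IsMaximalIdeal J → J = I) : Rad E = I :=
  Set.Subset.antisymm (Set.sInter_subset_of_mem hI)
    (Set.subset_sInter fun J hJ => (h J hJ).ge)

/-- Every proper ideal of an effect algebra lies in a maximal one. -/
theorem IsIdeal.exists_isMaximalIdeal {I : Set E} (hI : IsIdeal I) (h1 : (1 : E) ∉ I) :
    ∃ J : Set E, IsMaximalIdeal J ∧ I ⊆ J := by
  obtain ⟨J, hIJ, hJ⟩ := zorn_subset_nonempty {J : Set E | IsIdeal J ∧ (1 : E) ∉ J} (by
    rintro c hc hchain ⟨K, hK⟩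
    refine ⟨⋃₀ c, ⟨⟨?_, ?_, ?_⟩, ?_⟩, fun s hs => Set.subset_sUnion_of_mem hs⟩
    · exact ⟨0, K, hK, (hc hK).1.zero_mem⟩
    · rintro a b hab ⟨s, hs, hb⟩
      exact ⟨s, hs, (hc hs).1.mem_of_le hab hb⟩
    · rintro x y z ⟨s, hs, hx⟩ ⟨t, ht, hy⟩ hxyz
      rcases hchain.total hs ht with hst | hst
      · exact ⟨t, ht, (hc ht).1.mem_of_isSum (hst hx) hy hxyz⟩
      · exact ⟨s, hs, (hc hs).1.mem_of_isSum hx (hst hy) hxyz⟩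
    · rintro ⟨s, hs, h⟩
      exact (hc hs).2 h) I ⟨hI, h1⟩
  refine ⟨J, ⟨hJ.prop.1, fun h => hJ.prop.2 (h ▸ Set.mem_univ _), fun K hK hKu hJK => ?_⟩, hIJ⟩
  exact Set.Subset.antisymm hJK
    (hJ.le_of_ge ⟨hK, fun h => hKu (hK.eq_univ_iff.2 h)⟩ hJK)

end Basic

end EffectAlgebra

/-! ### Representations by intervals of po-groups -/

namespace EffectAlgebra

open PartialSumAlgebra

/-- `φ` identifies the effect algebra `E` with the interval `[0, u]` of the po-group `K`. -/
structure IsIntervalRep {E K : Type*} [EffectAlgebra E] [AddCommGroup K] [PartialOrder K]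
    (u : K) (φ : E → K) : Prop where
  injective : Function.Injective φ
  nonneg : ∀ x, 0 ≤ φ x
  le_unit : ∀ x, φ x ≤ u
  surjOn : ∀ k, 0 ≤ k → k ≤ u → ∃ x, φ x = k
  map_one : φ 1 = u
  isSum_iff : ∀ x y z, IsSum x y z ↔ φ z = φ x + φ y

set_option linter.unusedSectionVars false

section Interval

variable {E K : Type*} [EffectAlgebra E] [AddCommGroup K] [PartialOrder K] [IsOrderedAddMonoid K]
  {u : K} {φ : E → K}

/-- Definedness needs no separate clause in `IsIntervalRep`: if `φ z = φ x + φ y`, then `φ z ≤ u`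
already says `φ x ≤ u - φ y`. -/
theorem isomorphic_poGamma_iff (hu : 0 ≤ u) :
    Isomorphic E (PoGamma u hu) ↔ ∃ φ : E → K, IsIntervalRep u φ := by
  constructor
  · rintro ⟨e, he, he'⟩
    refine ⟨fun x => (e x).1, ⟨fun x y h => e.injective (Subtype.ext h), fun x => (e x).2.1,
      fun x => (e x).2.2, fun k h h' => ⟨e.symm ⟨k, h, h'⟩, congrArg Subtype.val (e.apply_symm_apply _)⟩, ?_, fun x y z => ?_⟩⟩
    · exact congrArg Subtype.val he.map_one
    · refine ⟨fun h => (he.map_isSum h).2, fun h => ?_⟩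
      have := he'.map_isSum (a := e x) (b := e y) (c := e z)
        ⟨by rw [le_sub_iff_add_le, ← h]; exact (e z).2.2, h⟩
      simpa using this
  · rintro ⟨φ, hφ⟩
    let f : E → PoGamma u hu := fun x => ⟨φ x, hφ.nonneg x, hφ.le_unit x⟩
    have hf : Function.Bijective f :=
      ⟨fun x y h => hφ.injective (congrArg Subtype.val h), fun k => by
        obtain ⟨x, hx⟩ := hφ.surjOn k.1 k.2.1 k.2.2
        exact ⟨x, Subtype.ext hx⟩⟩
    refine ⟨Equiv.ofBijective f hf, ⟨Subtype.ext hφ.map_one, fun {a b c} h => ?_⟩, ?_, ?_⟩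
    · have h' := (hφ.isSum_iff _ _ _).1 h
      exact ⟨by rw [le_sub_iff_add_le]; exact h' ▸ hφ.le_unit c, h'⟩
    · rw [Equiv.symm_apply_eq]
      exact (Subtype.ext hφ.map_one).symm
    · rintro a b c ⟨-, h⟩
      rw [hφ.isSum_iff]
      obtain ⟨x, rfl⟩ := (Equiv.ofBijective f hf).surjective a
      obtain ⟨y, rfl⟩ := (Equiv.ofBijective f hf).surjective b
      obtain ⟨z, rfl⟩ := (Equiv.ofBijective f hf).surjective c
      rw [Equiv.symm_apply_apply, Equiv.symm_apply_apply, Equiv.symm_apply_apply]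
      exact h

theorem IsIntervalRep.ele_iff (hφ : IsIntervalRep u φ) {x y : E} : ELe x y ↔ φ x ≤ φ y := by
  constructor
  · rintro ⟨z, hz⟩
    rw [(hφ.isSum_iff _ _ _).1 hz]
    exact le_add_of_nonneg_right (hφ.nonneg z)
  · intro h
    obtain ⟨z, hz⟩ := hφ.surjOn (φ y - φ x) (sub_nonneg.2 h)
      ((sub_le_self _ (hφ.nonneg x)).trans (hφ.le_unit y))
    exact ⟨z, (hφ.isSum_iff _ _ _).2 (by rw [hz]; abel)⟩

end Interval

/-! ### Lexicographic intervals: maximal ideal and retraction -/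

section LexInterval

variable {E H G : Type*} [EffectAlgebra E] [AddCommGroup H] [LinearOrder H] [IsOrderedAddMonoid H]
  [AddCommGroup G] [Lattice G] [IsOrderedAddMonoid G] {u : H} {φ : E → H ×ₗ G}

/-- The elements infinitely close to `0`. -/
def lexKernel (φ : E → H ×ₗ G) : Set E := {x | (ofLex (φ x)).1 = 0}

theorem IsIntervalRep.fst_nonneg (hφ : IsIntervalRep (toLex (u, (0 : G))) φ) (x : E) :
    0 ≤ (ofLex (φ x)).1 :=
  Prod.Lex.monotone_fst _ _ (hφ.nonneg x)

theorem IsIntervalRep.fst_le (hφ : IsIntervalRep (toLex (u, (0 : G))) φ) (x : E) :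
    (ofLex (φ x)).1 ≤ u :=
  Prod.Lex.monotone_fst _ _ (hφ.le_unit x)

theorem IsIntervalRep.isIdeal_lexKernel (hφ : IsIntervalRep (toLex (u, (0 : G))) φ) :
    IsIdeal (lexKernel φ) := by
  have hadd : ∀ {x y z}, IsSum x y z → (ofLex (φ z)).1 = (ofLex (φ x)).1 + (ofLex (φ y)).1 := by
    intro x y z h
    rw [(hφ.isSum_iff _ _ _).1 h]; rfl
  refine ⟨⟨0, ?_⟩, ?_, ?_⟩
  · have := hadd (isSum_zero_left (0 : E))
    exact left_eq_add.1 this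
  · rintro a b ⟨c, h⟩ hb
    have h1 := hadd h
    have h2 := hφ.fst_nonneg a
    have h3 := hφ.fst_nonneg c
    rw [show (ofLex (φ b)).1 = 0 from hb] at h1
    exact ((add_eq_zero_iff_of_nonneg h2 h3).1 h1.symm).1
  · intro a b c ha hb h
    have h1 := hadd h
    rw [show (ofLex (φ a)).1 = 0 from ha, show (ofLex (φ b)).1 = 0 from hb, add_zero] at h1
    exact h1

theorem IsIntervalRep.ele_of_fst_lt (hφ : IsIntervalRep (toLex (u, (0 : G))) φ) {x y : E}
    (h : (ofLex (φ x)).1 < (ofLex (φ y)).1) : ELe x y :=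
  hφ.ele_iff.2 (Prod.Lex.le_iff.2 (Or.inl h))

/-- An element `(t, g)` of the interval splits as `(t, g ⊓ h) + (0, g - g ⊓ h)`. -/
theorem IsIntervalRep.exists_split (hφ : IsIntervalRep (toLex (u, (0 : G))) φ) (hu : 0 < u) (y : E)
    (h : G) (hh : (ofLex (φ y)).1 = 0 → 0 ≤ h) :
    ∃ v w, IsSum w v y ∧ φ v = toLex ((ofLex (φ y)).1, (ofLex (φ y)).2 ⊓ h) ∧
      φ w = toLex (0, (ofLex (φ y)).2 - (ofLex (φ y)).2 ⊓ h) := by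
  have h0 := Prod.Lex.le_iff'.1 (hφ.nonneg y)
  have h1 := Prod.Lex.le_iff'.1 (hφ.le_unit y)
  obtain ⟨v, hv⟩ := hφ.surjOn (toLex ((ofLex (φ y)).1, (ofLex (φ y)).2 ⊓ h))
    (Prod.Lex.le_iff'.2 ⟨h0.1, fun h' => le_inf (h0.2 h') (hh h'.symm)⟩)
    (Prod.Lex.le_iff'.2 ⟨h1.1, fun h' => inf_le_left.trans (h1.2 h')⟩)
  obtain ⟨w, hw⟩ := hφ.surjOn (toLex ((0 : H), (ofLex (φ y)).2 - (ofLex (φ y)).2 ⊓ h))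
    (Prod.Lex.le_iff'.2 ⟨le_rfl, fun _ => sub_nonneg.2 inf_le_left⟩)
    (Prod.Lex.le_iff.2 (Or.inl hu))
  refine ⟨v, w, (hφ.isSum_iff _ _ _).2 ?_, hv, hw⟩
  rw [hv, hw, ← toLex_add, Prod.mk_add_mk, zero_add, sub_add_cancel]
  rfl

/-- An element of smaller first coordinate than `x` lies below `x`; from one of larger first
coordinate `x` can be subtracted. One of equal first coordinate may be incomparable with `x`, but it
splits into a part with second coordinate capped by that of `x` and a part of first coordinate `0`,
both below `x`. -/
theorem IsIntervalRep.mem_of_fst_le_nsmul (hφ : IsIntervalRep (toLex (u, (0 : G))) φ) (hu : 0 < u)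
    {I : Set E} (hI : IsIdeal I) {x : E} (hx : x ∈ I) (hx0 : 0 < (ofLex (φ x)).1) (n : ℕ) :
    ∀ {y : E}, (ofLex (φ y)).1 ≤ n • (ofLex (φ x)).1 → y ∈ I := by
  induction n with
  | zero =>
    intro y hy
    rw [zero_nsmul] at hy
    exact hI.mem_of_le (hφ.ele_of_fst_lt (hy.trans_lt hx0)) hx
  | succ n ih =>
    intro y hy
    rcases lt_trichotomy (ofLex (φ y)).1 (ofLex (φ x)).1 with h | h | h
    · exact hI.mem_of_le (hφ.ele_of_fst_lt h) hx
    · obtain ⟨v, w, hvw, hv, hw⟩ := hφ.exists_split hu y (ofLex (φ x)).2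
        (fun h' => absurd (h.symm.trans h') hx0.ne')
      refine hI.mem_of_isSum (hI.mem_of_le (hφ.ele_of_fst_lt ?_) hx)
        (hI.mem_of_le (hφ.ele_iff.2 ?_) hx) hvw
      · rw [hw]; exact hx0
      · rw [hv]; exact Prod.Lex.le_iff'.2 ⟨h.le, fun _ => inf_le_right⟩
    · obtain ⟨w, hw⟩ := hφ.ele_of_fst_lt h
      refine hI.mem_of_isSum hx (ih (y := w) ?_) hw
      rw [(hφ.isSum_iff _ _ _).1 hw, succ_nsmul'] at hy
      exact le_of_add_le_add_left hy

theorem IsIntervalRep.isMaximalIdeal_iff [Archimedean H] (hu : 0 < u)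
    (hφ : IsIntervalRep (toLex (u, (0 : G))) φ) (I : Set E) :
    IsMaximalIdeal I ↔ I = lexKernel φ := by
  have hle : ∀ J : Set E, IsIdeal J → J ≠ Set.univ → J ⊆ lexKernel φ := by
    intro J hJ hJu x hx
    by_contra hx0
    have hx0 : 0 < (ofLex (φ x)).1 := lt_of_le_of_ne (hφ.fst_nonneg x) (Ne.symm hx0)
    obtain ⟨n, hn⟩ := Archimedean.arch u hx0
    exact hJu (hJ.eq_univ_iff.2 (hφ.mem_of_fst_le_nsmul hu hJ hx hx0 n ((hφ.fst_le 1).trans hn)))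
  have hne : lexKernel φ ≠ Set.univ := by
    intro h
    have h1 : (ofLex (φ 1)).1 = 0 := (hφ.isIdeal_lexKernel.eq_univ_iff).1 h
    rw [hφ.map_one] at h1
    exact hu.ne' h1
  constructor
  · intro h
    exact h.eq_of_subset _ hφ.isIdeal_lexKernel hne (hle I h.isIdeal h.ne_univ)
  · rintro rfl
    exact ⟨hφ.isIdeal_lexKernel, hne, fun J hJ hJu h => h.antisymm (hle J hJ hJu)⟩

theorem IsIntervalRep.isRetractive_lexKernel (hu : 0 < u)
    (hφ : IsIntervalRep (toLex (u, (0 : G))) φ) : IsRetractive (lexKernel φ) := by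
  have hex : ∀ t : H, 0 ≤ t → t ≤ u → ∃ x, φ x = toLex (t, 0) := fun t h0 h1 =>
    hφ.surjOn _ (Prod.Lex.le_iff'.2 ⟨h0, fun _ => le_rfl⟩)
      (Prod.Lex.le_iff'.2 ⟨h1, fun _ => le_rfl⟩)
  choose r hr using fun x => hex _ (hφ.fst_nonneg x) (hφ.fst_le x)
  have hadd : ∀ {x y z}, IsSum x y z → (ofLex (φ z)).1 = (ofLex (φ x)).1 + (ofLex (φ y)).1 := by
    intro x y z h
    rw [(hφ.isSum_iff _ _ _).1 h]; rfl
  have hrel : ∀ a b, IdealRel (lexKernel φ) a b → r a = r b := by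
    rintro a b ⟨e, he, f, hf, d, h, h'⟩
    apply hφ.injective
    rw [hr, hr, hadd h, hadd h', show (ofLex (φ e)).1 = 0 from he,
      show (ofLex (φ f)).1 = 0 from hf]
  refine ⟨Quot.lift r hrel, ⟨?_, ?_⟩, ?_⟩
  · apply hφ.injective
    change φ (r 1) = φ 1
    rw [hr, hφ.map_one]; rfl
  · rintro _ _ _ ⟨a, b, c, h, rfl, rfl, rfl⟩
    change IsSum (r a) (r b) (r c)
    rw [hφ.isSum_iff, hr, hr, hr, hadd h, ← toLex_add, Prod.mk_add_mk, add_zero]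
  · rintro ⟨x⟩
    refine Quot.sound ?_
    -- For `φ x = (t, g)`, both `x` and `r x`, i.e. `(t, g)` and `(t, 0)`, exceed `(t, g ⊓ 0)` by an
    -- element of the kernel.
    obtain ⟨v, w, hvw, hv, hw⟩ := hφ.exists_split hu x 0 (fun _ => le_rfl)
    obtain ⟨v', w', hvw', hv', hw'⟩ := hφ.exists_split hu (r x) (ofLex (φ x)).2 (fun h => by
      rw [hr] at h
      have := Prod.Lex.le_iff'.1 (hφ.nonneg x)
      exact this.2 h.symm)
    have hvv : v' = v := by
      apply hφ.injective
      rw [hv, hv', hr, inf_comm]; rfl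
    refine ⟨w', ?_, w, ?_, v, hvv ▸ hvw', hvw⟩
    · show (ofLex (φ w')).1 = 0
      rw [hw']; rfl
    · show (ofLex (φ w)).1 = 0
      rw [hw]; rfl

theorem IsIntervalRep.isLocal_and_isRetractive_rad [Archimedean H] (hu : 0 < u)
    (hφ : IsIntervalRep (toLex (u, (0 : G))) φ) : IsLocal E ∧ IsRetractive (Rad E) := by
  have h := hφ.isMaximalIdeal_iff hu
  have hI := (h _).2 rfl
  refine ⟨⟨_, hI, fun J hJ => (h J).1 hJ⟩, ?_⟩
  rw [hI.rad_eq fun J hJ => (h J).1 hJ]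
  exact hφ.isRetractive_lexKernel hu

end LexInterval

end EffectAlgebra

/-! ### Positive cones of lattice-ordered groups -/

/-- A cancellative commutative monoid without nontrivial invertible elements whose natural order has
binary suprema is the positive cone of an Abelian lattice-ordered group. -/
theorem exists_latticeOrderedGroup_positiveCone (M : Type w) [AddCancelCommMonoid M]
    (hpos : ∀ a b : M, a + b = 0 → a = 0)
    (hlub : ∀ a b : M, ∃ j, (∃ r, a + r = j) ∧ (∃ r, b + r = j) ∧
      ∀ k, (∃ r, a + r = k) → (∃ r, b + r = k) → ∃ r, j + r = k) :
    ∃ (G : Type w) (_ : AddCommGroup G) (_ : Lattice G) (_ : IsOrderedAddMonoid G) (ι : M →+ G),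
      Function.Injective ι ∧ (∀ g, 0 ≤ g ↔ ∃ p, ι p = g) ∧ ∀ g, ∃ p q, g = ι p - ι q := by
  let G := Algebra.GrothendieckAddGroup M
  let ι : M →+ G := Algebra.GrothendieckAddGroup.of
  have hinj : Function.Injective ι := by
    intro a b h
    obtain ⟨c, hc⟩ := (AddLocalization.addMonoidOf (⊤ : AddSubmonoid M)).eq_iff_exists.1 h
    exact add_left_cancel hc
  have hsub : ∀ g : G, ∃ p q, g = ι p - ι q := by
    intro g
    obtain ⟨⟨p, q⟩, h⟩ := (AddLocalization.addMonoidOf (⊤ : AddSubmonoid M)).surj g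
    exact ⟨p, q, eq_sub_of_add_eq h⟩
  let po : PartialOrder G :=
    { le := fun g h => ∃ p, g + ι p = h
      le_refl := fun g => ⟨0, by simp⟩
      le_trans := by
        rintro a b c ⟨p, rfl⟩ ⟨q, rfl⟩
        exact ⟨p + q, by rw [map_add, add_assoc]⟩
      le_antisymm := by
        rintro a b ⟨p, rfl⟩ ⟨q, hq⟩
        rw [add_assoc, ← map_add, add_eq_left, ← map_zero ι] at hq
        rw [hpos p q (hinj hq), map_zero, add_zero] }
  have hle : ∀ g h : G, g ≤ h ↔ ∃ p, g + ι p = h := fun _ _ => Iff.rfl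
  have hord : IsOrderedAddMonoid G := ⟨by
    rintro a b ⟨p, rfl⟩ c
    exact ⟨p, by abel⟩, by
    rintro a b ⟨p, rfl⟩ c
    exact ⟨p, by abel⟩⟩
  have hι : ∀ a b : M, ι a ≤ ι b ↔ ∃ r, a + r = b := by
    intro a b
    rw [hle]
    exact exists_congr fun r => by rw [← map_add, hinj.eq_iff]
  have hsup : ∀ g h : G, ∃ j, IsLUB {g, h} j := by
    intro g h
    obtain ⟨a, b, rfl⟩ := hsub g
    obtain ⟨c, d, rfl⟩ := hsub h
    -- Translation by `ι (b + d)` moves both elements into the image of `M`, where suprema are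
    -- given.
    obtain ⟨j, hj1, hj2, hj⟩ := hlub (a + d) (c + b)
    rw [← hι] at hj1 hj2
    refine ⟨ι j - ι (b + d), ?_, ?_⟩
    · rintro x (rfl | rfl)
      · rw [le_sub_iff_add_le]
        refine le_trans (le_of_eq ?_) hj1
        rw [map_add, map_add]; abel
      · rw [le_sub_iff_add_le]
        refine le_trans (le_of_eq ?_) hj2
        rw [map_add, map_add]; abel
    · intro x hx
      obtain ⟨p, q, rfl⟩ := hsub x
      have h1 : ι a - ι b ≤ ι p - ι q := hx (Or.inl rfl)
      have h2 : ι c - ι d ≤ ι p - ι q := hx (Or.inr rfl)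
      -- The translated upper bound lies above `ι (a + d)`, so it is itself in the image of `M`,
      -- namely `ι (a + d + r)`; this makes `hj` applicable to it.
      obtain ⟨r, hr⟩ := (hι (a + d + q) (p + b + d)).1 (by
        rw [← sub_nonneg] at h1 ⊢
        refine h1.trans (le_of_eq ?_)
        simp only [map_add]; abel)
      obtain ⟨r', hr'⟩ := (hι (c + b + q) (p + b + d)).1 (by
        rw [← sub_nonneg] at h2 ⊢
        refine h2.trans (le_of_eq ?_)
        simp only [map_add]; abel)
      have hrr : a + d + r = c + b + r' := by
        apply add_right_cancel (b := q)
        rw [add_right_comm, hr, add_right_comm (c + b), hr']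
      have h3 := (hι _ _).2 (hj (a + d + r) ⟨r, rfl⟩ ⟨r', hrr.symm⟩)
      rw [← sub_nonneg] at h3 ⊢
      refine h3.trans (le_of_eq ?_)
      have h4 : ι a + ι d + ι r = ι p + ι b + ι d - ι q := by
        rw [eq_sub_iff_add_eq]
        simp only [← map_add]
        rw [add_right_comm, hr]
      simp only [map_add]
      rw [h4]; abel
  choose sup hsup using hsup
  have hsup_left : ∀ g h, g ≤ sup g h := fun g h => (hsup g h).1 (Or.inl rfl)
  have hsup_right : ∀ g h, h ≤ sup g h := fun g h => (hsup g h).1 (Or.inr rfl)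
  have hsup_le : ∀ g h x, g ≤ x → h ≤ x → sup g h ≤ x := fun g h x h1 h2 =>
    (hsup g h).2 (by rintro y (rfl | rfl) <;> assumption)
  refine ⟨G, inferInstance,
    { po with
      sup := sup
      le_sup_left := hsup_left
      le_sup_right := hsup_right
      sup_le := hsup_le
      inf := fun g h => -sup (-g) (-h)
      inf_le_left := fun g h => neg_le.1 (hsup_left _ _)
      inf_le_right := fun g h => neg_le.1 (hsup_right _ _)
      le_inf := fun g h x h1 h2 => le_neg.1 (hsup_le _ _ _ (neg_le_neg h1) (neg_le_neg h2)) },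
    hord, ι, hinj, fun g => ?_, hsub⟩
  change (∃ p, 0 + ι p = g) ↔ _
  simp

/-! ### From a splitting to a lexicographic representation -/

namespace EffectAlgebra

open PartialSumAlgebra

/-- `s` maps `E` onto the interval `[0, u]` of `H` and respects sums, elements with larger value
are larger, the fibres of `s` are downwards directed, and `c` chooses one element of every fibre in
an additive way. -/
structure IsSplitting {E H : Type*} [EffectAlgebra E] [AddCommGroup H] [LinearOrder H]
    [IsOrderedAddMonoid H] (u : H) (s : E → H) (c : E → E) : Prop where
  unit_pos : 0 < u
  nonneg : ∀ x, 0 ≤ s x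
  surjOn : ∀ t, 0 ≤ t → t ≤ u → ∃ x, s x = t
  map_one : s 1 = u
  map_isSum : ∀ {x y z}, IsSum x y z → s z = s x + s y
  ele_of_lt : ∀ {x y}, s x < s y → ELe x y
  directed : ∀ {x y}, s x = s y → ∃ z, s z = s x ∧ ELe z x ∧ ELe z y
  sec_congr : ∀ {x y}, s x = s y → c x = c y
  map_sec : ∀ x, s (c x) = s x
  isSum_sec : ∀ {x y z}, s z = s x + s y → IsSum (c x) (c y) (c z)
  sec_one : c 1 = 1

namespace IsSplitting

variable {E H : Type*} [EffectAlgebra E] [AddCommGroup H] [LinearOrder H]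
    [IsOrderedAddMonoid H] {u : H} {s : E → H} {c : E → E}

theorem map_zero (h : IsSplitting u s c) : s 0 = 0 :=
  left_eq_add.1 (h.map_isSum (isSum_zero_left 0))

theorem map_compl (h : IsSplitting u s c) (x : E) : s (compl x) = u - s x := by
  rw [← h.map_one, h.map_isSum (isSum_compl x), add_sub_cancel_left]

theorem le_unit (h : IsSplitting u s c) (x : E) : s x ≤ u :=
  sub_nonneg.1 (h.map_compl x ▸ h.nonneg _)

theorem map_eq_zero_of_isSum (h : IsSplitting u s c) {x y z : E} (hxy : IsSum x y z)
    (hs : s x = s z) : s y = 0 := by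
  have := h.map_isSum hxy
  rw [hs] at this
  exact left_eq_add.1 this

theorem exists_isSum (h : IsSplitting u s c) {x y : E} (hxy : s x + s y < u) :
    ∃ z, IsSum x y z :=
  exists_isSum_iff.2 (h.ele_of_lt (by rw [h.map_compl]; exact lt_sub_iff_add_lt.2 hxy))

/-- Because `0 + 0 < u`, the partial sum is total on the kernel, which makes the kernel a monoid. -/
theorem exists_isSum_kernel (h : IsSplitting u s c) (x y : {x : E // s x = 0}) :
    ∃ z : {x : E // s x = 0}, IsSum x.1 y.1 z.1 := by
  obtain ⟨z, hz⟩ := h.exists_isSum (x := x.1) (y := y.1) (by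
    rw [x.2, y.2, add_zero]; exact h.unit_pos)
  exact ⟨⟨z, by rw [h.map_isSum hz, x.2, y.2, add_zero]⟩, hz⟩

/-- The elements of value `0` form a cancellative commutative monoid. -/
noncomputable abbrev kernelMonoid (h : IsSplitting u s c) :
    AddCancelCommMonoid {x : E // s x = 0} where
  zero := ⟨0, h.map_zero⟩
  add x y := (h.exists_isSum_kernel x y).choose
  add_assoc x y z := by
    obtain ⟨f, hf, hxf⟩ := isSum_assoc.1 ⟨_, (h.exists_isSum_kernel x y).choose_spec,
      (h.exists_isSum_kernel (h.exists_isSum_kernel x y).choose z).choose_spec⟩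
    obtain rfl := isSum_unique hf (h.exists_isSum_kernel y z).choose_spec
    exact Subtype.ext (isSum_unique hxf (h.exists_isSum_kernel _ _).choose_spec)
  add_comm x y := Subtype.ext (isSum_unique (h.exists_isSum_kernel x y).choose_spec
    (isSum_comm.1 (h.exists_isSum_kernel y x).choose_spec))
  zero_add x := Subtype.ext (isSum_unique (h.exists_isSum_kernel _ x).choose_spec
    (isSum_zero_left _))
  add_zero x := Subtype.ext (isSum_unique (h.exists_isSum_kernel x _).choose_spec
    (isSum_zero_right _))
  add_left_cancel x y z hxy := by
    have h1 := (h.exists_isSum_kernel x y).choose_spec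
    have h2 := (h.exists_isSum_kernel x z).choose_spec
    have h3 : (h.exists_isSum_kernel x y).choose = (h.exists_isSum_kernel x z).choose := hxy
    rw [h3] at h1
    exact Subtype.ext (isSum_left_cancel h1 h2)
  nsmul := @nsmulRec _ ⟨⟨0, h.map_zero⟩⟩ ⟨fun x y => (h.exists_isSum_kernel x y).choose⟩

theorem exists_lex_isIntervalRep {E : Type w} [EffectAlgebra E] {s : E → H} {c : E → E}
    (h : IsSplitting u s c)
    (hlub : ∀ a b : E, ∃ j, ELe a j ∧ ELe b j ∧ ∀ k, ELe a k → ELe b k → ELe j k) :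
    ∃ (G : Type w) (_ : AddCommGroup G) (_ : Lattice G) (_ : IsOrderedAddMonoid G)
      (φ : E → H ×ₗ G), IsIntervalRep (toLex (u, (0 : G))) φ := by
  let _ := h.kernelMonoid
  have hadd : ∀ x y : {x : E // s x = 0}, IsSum x.1 y.1 (x + y).1 := fun x y =>
    (h.exists_isSum_kernel x y).choose_spec
  have hker : ∀ {x y : E}, ELe x y → s y = 0 → s x = 0 := by
    rintro x y ⟨z, hz⟩ hy
    have h1 := h.map_isSum hz
    rw [hy] at h1
    exact ((add_eq_zero_iff_of_nonneg (h.nonneg _) (h.nonneg _)).1 h1.symm).1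
  have hkle : ∀ x y : {x : E // s x = 0}, (∃ r, x + r = y) ↔ ELe x.1 y.1 := by
    intro x y
    constructor
    · rintro ⟨r, rfl⟩
      exact ⟨r.1, hadd x r⟩
    · rintro ⟨r, hr⟩
      refine ⟨⟨r, hker (ele_of_isSum_right hr) y.2⟩, Subtype.ext ?_⟩
      exact isSum_unique (hadd _ _) hr
  obtain ⟨G, i1, i2, i3, ι, hinj, hpos, hsub⟩ :=
    exists_latticeOrderedGroup_positiveCone {x : E // s x = 0} (by
      intro a b hab
      have h1 := hadd a b
      rw [hab] at h1
      exact Subtype.ext (left_eq_zero_of_isSum_zero h1)) (by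
      intro a b
      obtain ⟨j, hj1, hj2, hj⟩ := hlub a.1 b.1
      -- The supremum stays in the kernel because `a + b` is an upper bound there.
      have hj0 : s j = 0 := hker (hj _ ⟨b.1, hadd a b⟩ (ele_of_isSum_right (hadd a b))) (a + b).2
      refine ⟨⟨j, hj0⟩, (hkle _ _).2 hj1, (hkle _ _).2 hj2, fun k h1 h2 => (hkle _ _).2 ?_⟩
      exact hj _ ((hkle _ _).1 h1) ((hkle _ _).1 h2))
  refine ⟨G, i1, i2, i3, ?_⟩
  have hassoc : ∀ {m m' x : E} {r p : {x : E // s x = 0}}, IsSum m r.1 m' → IsSum m' p.1 x →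
      IsSum m (r + p).1 x := by
    intro m m' x r p h1 h2
    obtain ⟨f, hf, hmf⟩ := isSum_assoc.1 ⟨m', h1, h2⟩
    exact isSum_unique hf (hadd r p) ▸ hmf
  have hfib : ∀ {x y : E}, ELe x y → s x = s y → ∃ r : {x : E // s x = 0}, IsSum x r.1 y := by
    rintro x y ⟨r, hr⟩ hs
    exact ⟨⟨r, h.map_eq_zero_of_isSum hr hs⟩, hr⟩
  have hex : ∀ x : E, ∃ (m : E) (p q : {x : E // s x = 0}), IsSum m p.1 x ∧ IsSum m q.1 (c x) := by
    intro x
    obtain ⟨m, hm, hmx, hmc⟩ := h.directed (h.map_sec x).symm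
    obtain ⟨p, hp⟩ := hfib hmx hm
    obtain ⟨q, hq⟩ := hfib hmc (by rw [hm, h.map_sec])
    exact ⟨m, p, q, hp, hq⟩
  choose m p q hp hq using hex
  have hsm : ∀ {n x : E} {r : {x : E // s x = 0}}, IsSum n r.1 x → s n = s x := by
    intro n x r hr
    rw [h.map_isSum hr, r.2, add_zero]
  have huniq : ∀ (x n : E) (a b : {x : E // s x = 0}), IsSum n a.1 x → IsSum n b.1 (c x) →
      ι (p x) - ι (q x) = ι a - ι b := by
    intro x n a b ha hb
    -- Two base points `n` and `m x` are compared over a common lower bound `k` in their fibre: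
    -- passing to `k` adds the same kernel element to both terms of a difference.
    obtain ⟨k, hk, hkn, hkm⟩ := h.directed ((hsm ha).trans (hsm (hp x)).symm)
    obtain ⟨r, hr⟩ := hfib hkn hk
    obtain ⟨r', hr'⟩ := hfib hkm (by rw [hk, hsm ha, hsm (hp x)])
    have h1 : r + a = r' + p x :=
      Subtype.ext (isSum_left_cancel (hassoc hr ha) (hassoc hr' (hp x)))
    have h2 : r + b = r' + q x :=
      Subtype.ext (isSum_left_cancel (hassoc hr hb) (hassoc hr' (hq x)))
    have h1 := congrArg ι h1
    have h2 := congrArg ι h2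
    rw [map_add, map_add] at h1 h2
    rw [← add_sub_add_left_eq_sub (ι a) (ι b) (ι r), h1, h2, add_sub_add_left_eq_sub]
  let φ : E → H ×ₗ G := fun x => toLex (s x, ι (p x) - ι (q x))
  have hφadd : ∀ {x y z}, IsSum x y z → φ z = φ x + φ y := by
    intro x y z hxy
    have hs := h.map_isSum hxy
    obtain ⟨n, a, hn, ha, hna⟩ := isSum_isSum_isSum_comm (hp x) (hp y) hxy
    obtain ⟨n', b, hn', hb, hnb⟩ := isSum_isSum_isSum_comm (hq x) (hq y) (h.isSum_sec hs)
    obtain rfl := isSum_unique hn hn'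
    obtain rfl := isSum_unique ha (hadd _ _)
    obtain rfl := isSum_unique hb (hadd _ _)
    have h1 := huniq z n _ _ hna hnb
    simp only [φ, ← toLex_add, Prod.mk_add_mk, hs, h1, map_add]
    rw [sub_add_sub_comm]
  have hrefl : ∀ {x y}, φ x ≤ φ y → ELe x y := by
    intro x y hxy
    rcases Prod.Lex.le_iff.1 hxy with hlt | ⟨heq, hle⟩
    · exact h.ele_of_lt hlt
    · have heq : s x = s y := heq
      have hle : ι (p x) - ι (q x) ≤ ι (p y) - ι (q y) := hle
      obtain ⟨k, hk, hkx, hky⟩ := h.directed heq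
      -- As `c x = c y`, one base point `n` serves for `x`, `y` and the section at once, so
      -- comparing second coordinates reduces to comparing `a` and `b` in the cone.
      obtain ⟨n, hn, hnk, hnc⟩ := h.directed (hk.trans (h.map_sec x).symm)
      obtain ⟨a, ha⟩ := hfib (ele_trans hnk hkx) (hn.trans hk)
      obtain ⟨b, hb⟩ := hfib (ele_trans hnk hky) (hn.trans (hk.trans heq))
      obtain ⟨d, hd⟩ := hfib hnc (by rw [hn, hk, h.map_sec])
      rw [huniq x n a d ha hd, huniq y n b d hb (h.sec_congr heq ▸ hd), sub_le_sub_iff_right,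
        ← sub_nonneg, hpos] at hle
      obtain ⟨r, hr⟩ := hle
      have hab : a + r = b := hinj (by rw [map_add, hr, add_sub_cancel])
      obtain ⟨f, hf, hxf⟩ := isSum_assoc.2 ⟨_, hab ▸ hadd a r, hb⟩
      exact ⟨r.1, isSum_unique ha hf ▸ hxf⟩
  have hφone : φ 1 = toLex (u, 0) := by
    have hq1 := hq 1
    rw [h.sec_one] at hq1
    have h1 : p 1 = q 1 := Subtype.ext (isSum_left_cancel (hp 1) hq1)
    simp only [φ, h.map_one, h1, sub_self]
  have hsec0 : c 0 = 0 := by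
    have h1 : IsSum (c 0) (c 0) (c 0) := h.isSum_sec (by rw [h.map_zero, add_zero])
    exact isSum_left_cancel h1 (isSum_zero_right _)
  have hker' : ∀ {x : E} (hx : s x = 0), φ x = toLex (0, ι ⟨x, hx⟩) := by
    intro x hx
    have h1 := huniq x 0 ⟨x, hx⟩ 0 (isSum_zero_left x) (by
      rw [h.sec_congr (hx.trans h.map_zero.symm), hsec0]; exact isSum_zero_left 0)
    simp only [φ, h1, hx, _root_.map_zero, sub_zero]
  have hnonneg : ∀ x, 0 ≤ φ x := by
    intro x
    rcases (h.nonneg x).eq_or_lt with hx | hx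
    · rw [hker' hx.symm]
      exact Prod.Lex.le_iff'.2 ⟨le_rfl, fun _ => (hpos _).2 ⟨_, rfl⟩⟩
    · exact Prod.Lex.le_iff.2 (Or.inl hx)
  have hcompl : ∀ x, φ (compl x) = toLex (u, 0) - φ x := by
    intro x
    rw [← hφone, hφadd (isSum_compl x), add_sub_cancel_left]
  have hzero : ∀ g : G, 0 ≤ g → ∃ x, φ x = toLex (0, g) := by
    intro g hg
    obtain ⟨r, rfl⟩ := (hpos _).1 hg
    exact ⟨r.1, hker' r.2⟩
  have hinjφ : Function.Injective φ := fun x y hxy => ele_antisymm (hrefl hxy.le) (hrefl hxy.ge)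
  have hle : ∀ x, φ x ≤ toLex (u, 0) := fun x => sub_nonneg.1 (hcompl x ▸ hnonneg _)
  refine ⟨φ, hinjφ, hnonneg, hle, ?_, hφone, fun x y z => ⟨hφadd, fun hxy => ?_⟩⟩
  · intro k hk0 hk1
    obtain ⟨⟨t, g⟩, rfl⟩ := toLex.surjective k
    rcases Prod.Lex.le_iff.1 hk0 with ht | ⟨ht, hg⟩
    · rcases Prod.Lex.le_iff.1 hk1 with ht1 | ⟨ht1, hg⟩
      · have ht : 0 < t := ht
        have ht1 : t < u := ht1
        obtain ⟨a, b, rfl⟩ := hsub g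
        obtain ⟨x, rfl⟩ := h.surjOn t ht.le ht1.le
        -- The preimage of `(t, ι a - ι b)` is `(c x - b) + a`: the difference exists because `0 <
        -- t`, the sum because `t < u`.
        obtain ⟨n, hn⟩ := h.ele_of_lt (x := b.1) (y := c x) (by rwa [b.2, h.map_sec])
        have hn' := isSum_comm.1 hn
        have hsn : s n = s x := by rw [hsm hn', h.map_sec]
        obtain ⟨y, hy⟩ := h.exists_isSum (x := n) (y := a.1) (by rwa [a.2, add_zero, hsn])
        have hsy : s y = s x := by rw [← hsm hy, hsn]
        refine ⟨y, ?_⟩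
        have h1 := huniq y n a b hy (h.sec_congr hsy ▸ hn')
        simp only [φ, h1, hsy]
      · have ht1 : t = u := ht1
        -- On the top fibre `g ≤ 0`, and `(u, g)` is the complement of `(0, -g)`.
        obtain ⟨x, hx⟩ := hzero (-g) (neg_nonneg.2 hg)
        refine ⟨compl x, ?_⟩
        rw [hcompl, hx, ht1, ← toLex_sub, Prod.mk_sub_mk, sub_zero, sub_neg_eq_add, zero_add]
    · have ht : 0 = t := ht
      exact ht ▸ hzero g hg
  · obtain ⟨v, hv⟩ := exists_isSum_iff.2 (hrefl (x := x) (y := compl y) (by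
      rw [hcompl, le_sub_iff_add_le, ← hxy]; exact hle z))
    have : v = z := hinjφ (by rw [hφadd hv, hxy])
    exact this ▸ hv

end IsSplitting

end EffectAlgebra

/-! ### Splittings and strong perfect decompositions -/

namespace EffectAlgebra

open PartialSumAlgebra

variable {E H : Type*} [EffectAlgebra E] [AddCommGroup H] [LinearOrder H]
    [IsOrderedAddMonoid H] {u : H}

theorem IsSplitting.isStrongPerfect {s : E → H} {c : E → E} (h : IsSplitting u s c)
    (hE : RDP E) (hu : 0 ≤ u) : IsStrongPerfect E u hu := by
  choose f hf using fun t : PoGamma u hu => h.surjOn t.1 t.2.1 t.2.2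
  refine ⟨hE, fun t => {x | s x = t.1}, ⟨fun t => ⟨f t, hf t⟩, ?_, ?_, ?_, ?_⟩, ?_, ?_,
    fun t => c (f t), fun t => (h.map_sec _).trans (hf t), ?_, ?_⟩
  · intro t r htr
    ext x
    simp only [Set.mem_inter_iff, Set.mem_ofPred_eq, Set.mem_empty_iff_false, iff_false, not_and]
    exact fun h1 h2 => htr (Subtype.ext (h1.symm.trans h2))
  · exact Set.eq_univ_of_forall fun x => Set.mem_iUnion.2 ⟨⟨s x, h.nonneg x, h.le_unit x⟩, rfl⟩
  · intro t r htr
    ext x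
    constructor
    · rintro ⟨y, hy, rfl⟩
      have hy : s y = t.1 := hy
      show s (compl y) = r.1
      rw [h.map_compl, hy, htr]
    · intro hx
      have hx : s x = r.1 := hx
      refine ⟨compl x, ?_, compl_compl x⟩
      show s (compl x) = t.1
      rw [h.map_compl, hx, htr, sub_sub_cancel]
  · intro t r x y z hx hy hxy
    have hx : s x = t.1 := hx
    have hy : s y = r.1 := hy
    rw [← hx, ← hy, ← h.map_isSum hxy]
    exact ⟨h.le_unit z, ⟨s z, h.nonneg z, h.le_unit z⟩, rfl, rfl⟩
  · intro t r htr x hx y hy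
    exact h.ele_of_lt (by rwa [show s x = t.1 from hx, show s y = r.1 from hy])
  · intro t
    constructor
    · intro x hx y hy
      have hx : s x = t.1 := hx
      have hy : s y = t.1 := hy
      -- A splitting has only downward directed fibres; complements turn this into upward
      -- directedness.
      obtain ⟨z, hz, hzx, hzy⟩ := h.directed (x := compl x) (y := compl y)
        (by rw [h.map_compl, h.map_compl, hx, hy])
      refine ⟨compl z, ?_, ?_, ?_⟩
      · show s (compl z) = t.1
        rw [h.map_compl, hz, h.map_compl, hx, sub_sub_cancel]
      · rw [← compl_compl x]; exact compl_ele_compl hzx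
      · rw [← compl_compl y]; exact compl_ele_compl hzy
    · intro x hx y hy
      have hx : s x = t.1 := hx
      have hy : s y = t.1 := hy
      obtain ⟨z, hz, hzxy⟩ := h.directed (hx.trans hy.symm)
      exact ⟨z, hz.trans hx, hzxy⟩
  · intro v t r hr
    exact h.isSum_sec (by rw [hf, hf, hf, hr])
  · show c (f 1) = 1
    rw [h.sec_congr (y := 1) (by rw [hf, h.map_one]; rfl), h.sec_one]

theorem IsStrongPerfect.exists_isSplitting {hu : 0 ≤ u} (hu' : 0 < u)
    (h : IsStrongPerfect E u hu) : ∃ (s : E → H) (c : E → E), IsSplitting u s c := by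
  obtain ⟨-, D, hD, hord, hdir, c, hcD, hc, hc1⟩ := h
  have hex : ∀ x : E, ∃ t, x ∈ D t := fun x => Set.mem_iUnion.1 (hD.iUnion_eq ▸ Set.mem_univ x)
  choose τ hτ using hex
  have huniq : ∀ {x t}, x ∈ D t → τ x = t := by
    intro x t hx
    by_contra hne
    exact (hD.disjoint _ _ hne).subset ⟨hτ x, hx⟩
  have hadd : ∀ {x y z}, IsSum x y z → (τ z).1 = (τ x).1 + (τ y).1 := by
    intro x y z hxy
    obtain ⟨-, r, hr, hz⟩ := hD.add_mem _ _ x y z (hτ x) (hτ y) hxy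
    rw [huniq hz, hr]
  have h1 : τ 1 = 1 := by rw [← hc1]; exact huniq (hcD 1)
  refine ⟨fun x => (τ x).1, fun x => c (τ x), hu', fun x => (τ x).2.1, fun t h0 h1 => ?_,
    congrArg Subtype.val h1, hadd, fun hxy => hord _ _ hxy _ (hτ _) _ (hτ _), ?_, ?_, ?_, ?_, ?_⟩
  · obtain ⟨x, hx⟩ := hD.nonempty ⟨t, h0, h1⟩
    exact ⟨x, congrArg Subtype.val (huniq hx)⟩
  · intro x y hxy
    have hxy : τ x = τ y := Subtype.ext hxy
    obtain ⟨z, hz, hzxy⟩ := (hdir (τ x)).2 x (hτ x) y (hxy ▸ hτ y)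
    exact ⟨z, congrArg Subtype.val (huniq hz), hzxy⟩
  · intro x y hxy
    exact congrArg c (Subtype.ext hxy)
  · intro x
    exact congrArg Subtype.val (huniq (hcD _))
  · intro x y z hz
    exact hc _ _ _ hz
  · show c (τ 1) = 1
    rw [h1, hc1]

theorem ele_of_isSum_isSum {a b c a' b' : E} (h : ELe a a') (h₁ : IsSum a b c)
    (h₂ : IsSum a' b' c) : ELe b' b := by
  obtain ⟨q, hq⟩ := h
  obtain ⟨f, hf, haf⟩ := isSum_assoc.1 ⟨a', hq, h₂⟩
  exact isSum_left_cancel haf h₁ ▸ ele_of_isSum_right hf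

end EffectAlgebra

/-! ### Arithmetic of MV-algebras -/

namespace MVAlgebra

open EffectAlgebra PartialSumAlgebra

variable {M : Type*} [MVAlgebra M] {a b c x y z w : M}

theorem zero_oplus (x : M) : oplus 0 x = x := by rw [oplus_comm, oplus_zero]

/-- Truncated difference. -/
def ominus (x y : M) : M := neg (oplus (neg x) y)

theorem oplus_ominus_comm (x y : M) : oplus x (ominus y x) = oplus y (ominus x y) := by
  rw [ominus, ominus, oplus_comm (neg y), oplus_comm (neg x)]
  exact oplus_neg_swap x y

theorem isSum_oplus_ominus (x y : M) : IsSum x (ominus y x) (oplus x (ominus y x)) := by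
  refine ⟨?_, rfl⟩
  rw [MLe, ominus, neg_neg, oplus_comm (neg y), ← oplus_assoc, oplus_comm (neg x),
    oplus_neg_self, oplus_comm, oplus_one]

theorem oplus_ominus_of_mle (h : MLe x y) : oplus x (ominus y x) = y := by
  rw [oplus_ominus_comm, ominus, show oplus (neg x) y = 1 from h, neg_one, oplus_zero]

theorem ele_iff_mle : ELe x y ↔ MLe x y := by
  constructor
  · rintro ⟨z, -, hz⟩
    exact (mle_iff _ _).2 ⟨z, hz⟩
  · intro h
    have h' := isSum_oplus_ominus x y
    rw [oplus_ominus_of_mle h] at h'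
    exact ⟨_, h'⟩

theorem ele_oplus_left (x y : M) : ELe x (oplus x y) := ele_iff_mle.2 ((mle_iff _ _).2 ⟨y, rfl⟩)

theorem ele_oplus_right (x y : M) : ELe y (oplus x y) := oplus_comm x y ▸ ele_oplus_left y x

/-- Residuation: both sides unfold to `x* ⊕ y ⊕ z = 1`. -/
theorem ominus_ele_iff : ELe (ominus x y) z ↔ ELe x (oplus y z) := by
  rw [ele_iff_mle, ele_iff_mle, MLe, MLe, ominus, neg_neg, oplus_assoc]

theorem oplus_ele_oplus_right (h : ELe x y) (z : M) : ELe (oplus x z) (oplus y z) := by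
  obtain ⟨w, -, rfl⟩ := h
  rw [oplus_assoc, oplus_comm w, ← oplus_assoc]
  exact ele_oplus_left _ _

theorem oplus_ele_oplus_left (h : ELe x y) (z : M) : ELe (oplus z x) (oplus z y) := by
  rw [oplus_comm z, oplus_comm z]
  exact oplus_ele_oplus_right h z

theorem ominus_ele (x y : M) : ELe (ominus x y) x := ominus_ele_iff.2 (ele_oplus_right _ _)

theorem ele_oplus_ominus (x y : M) : ELe x (oplus y (ominus x y)) :=
  ominus_ele_iff.1 (ele_refl _)

theorem ele_of_ominus_eq_zero (h : ominus x y = 0) : ELe x y := by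
  have h' := ele_oplus_ominus x y
  rwa [h, oplus_zero] at h'

theorem ominus_eq_zero (h : ELe x y) : ominus x y = 0 :=
  eq_zero_of_ele_zero (ominus_ele_iff.2 (by rwa [oplus_zero]))

theorem ominus_neg_neg (x y : M) : ominus (neg x) (neg y) = ominus y x := by
  rw [ominus, ominus, neg_neg, oplus_comm]

/-- Binary suprema exist in an MV-algebra. -/
theorem exists_isLUB (a b : M) :
    ∃ j, ELe a j ∧ ELe b j ∧ ∀ k, ELe a k → ELe b k → ELe j k := by
  refine ⟨oplus a (ominus b a), ele_oplus_left _ _, ele_oplus_ominus _ _, fun k ha hb => ?_⟩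
  rw [← oplus_ominus_of_mle (ele_iff_mle.1 ha)]
  apply oplus_ele_oplus_left
  rw [ominus_ele_iff, oplus_ominus_of_mle (ele_iff_mle.1 ha)]
  exact hb

/-- The meet of two elements. -/
def meet (x y : M) : M := ominus x (ominus x y)

theorem meet_comm (x y : M) : meet x y = meet y x := by
  have h := oplus_neg_swap (neg x) (neg y)
  rw [neg_neg, neg_neg] at h
  rw [meet, meet, ominus, ominus, ominus, ominus, h]

theorem isSum_meet_ominus (x y : M) : IsSum (meet x y) (ominus x y) x := by
  have h := isSum_oplus_ominus (ominus x y) x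
  rw [oplus_ominus_of_mle (ele_iff_mle.1 (ominus_ele x y))] at h
  exact isSum_comm.1 h

theorem isSum_meet_ominus' (x y : M) : IsSum (meet x y) (ominus y x) y :=
  meet_comm x y ▸ isSum_meet_ominus y x

theorem ele_meet (hx : ELe w x) (hy : ELe w y) : ELe w (meet x y) := by
  obtain ⟨r, hr⟩ := hx
  refine ele_of_isSum_isSum (a := ominus x y) (a' := r) ?_
    (isSum_comm.1 (isSum_meet_ominus x y)) (isSum_comm.1 hr)
  rw [ominus_ele_iff, hr.2]
  exact oplus_ele_oplus_right hy r

/-- The refinement is `c₁₁ = a₁ ∧ b₁`, `c₁₂ = a₁ ⊖ b₁`, `c₂₁ = b₁ ⊖ a₁`, with `c₂₂` the rest of `b₂`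
above `a₁ ⊖ b₁`. -/
theorem rdp (M : Type*) [MVAlgebra M] : RDP M := by
  intro a₁ a₂ b₁ b₂ s ha hb
  obtain ⟨r, hr⟩ : ELe (ominus a₁ b₁) b₂ := by
    rw [ominus_ele_iff, ← hb.2]
    exact ele_of_isSum_left ha
  obtain ⟨p, q, hp, hq, hpq⟩ := isSum_isSum_isSum_comm (isSum_meet_ominus' a₁ b₁) hr hb
  obtain rfl := isSum_unique hp (isSum_meet_ominus a₁ b₁)
  obtain rfl := isSum_left_cancel hpq ha
  exact ⟨_, _, _, _, hp, hq, isSum_meet_ominus' _ _, hr⟩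

/-- Such a `w` can be added to `x ∧ y` with the sum still below `x` and `y`, hence below `x ∧ y`. -/
theorem eq_zero_of_ele_ominus_ominus (h : ELe w (ominus x y)) (h' : ELe w (ominus y x)) :
    w = 0 := by
  obtain ⟨d, hd, hdx⟩ := exists_isSum_of_ele h (isSum_comm.1 (isSum_meet_ominus x y))
  obtain ⟨d', hd', hdy⟩ := exists_isSum_of_ele h' (isSum_comm.1 (isSum_meet_ominus' x y))
  obtain rfl := isSum_unique hd hd'
  exact eq_zero_of_ele_zero (ele_of_isSum_ele_isSum (ele_meet hdx hdy) (isSum_comm.1 hd)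
    (isSum_zero_right _))

/-- `x ⊕ ⋯ ⊕ x` with `n` summands. -/
def nmul : ℕ → M → M
  | 0, _ => 0
  | n + 1, x => oplus x (nmul n x)

theorem nmul_add (m n : ℕ) (x : M) : nmul (m + n) x = oplus (nmul m x) (nmul n x) := by
  induction m with
  | zero => rw [Nat.zero_add, nmul, zero_oplus]
  | succ m ih => rw [Nat.succ_add, nmul, nmul, ih, oplus_assoc]

theorem nmul_eq_one_of_le {m n : ℕ} (hmn : m ≤ n) (h : nmul m x = 1) : nmul n x = 1 := by
  obtain ⟨k, rfl⟩ := Nat.exists_eq_add_of_le hmn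
  rw [nmul_add, h, oplus_comm, oplus_one]

/-- Disjointness from `b` passes to multiples: `w ⊖ nb` lies below `a` and `b`, so it vanishes and
the multiple drops from `n + 1` to `n`. -/
theorem eq_zero_of_ele_nmul (h : ∀ w : M, ELe w a → ELe w b → w = 0) (n : ℕ) :
    ∀ {w : M}, ELe w a → ELe w (nmul n b) → w = 0 := by
  induction n with
  | zero => exact fun _ hw => eq_zero_of_ele_zero hw
  | succ n ih =>
    intro w ha hw
    rw [nmul, oplus_comm, ← ominus_ele_iff] at hw
    exact ih ha (ele_of_ominus_eq_zero (h _ (ele_trans (ominus_ele _ _) ha) hw))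

/-- Ideals are closed under defined sums only, but `x ⊕ y` is the defined sum of `x` and an element
below `y`. -/
theorem _root_.EffectAlgebra.IsIdeal.oplus_mem {I : Set M} (hI : IsIdeal I) (hx : x ∈ I)
    (hy : y ∈ I) : oplus x y ∈ I := by
  have h := isSum_oplus_ominus x (oplus x y)
  rw [oplus_ominus_of_mle (ele_iff_mle.1 (ele_oplus_left x y))] at h
  exact hI.mem_of_isSum hx (hI.mem_of_le (ominus_ele_iff.2 (ele_refl _)) hy) h

theorem isIdeal_principal (x : M) : IsIdeal {z : M | ∃ n, ELe z (nmul n x)} := by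
  refine ⟨⟨0, 0, ele_refl _⟩, ?_, ?_⟩
  · rintro a b hab ⟨n, hn⟩
    exact ⟨n, ele_trans hab hn⟩
  · rintro a b _ ⟨m, hm⟩ ⟨n, hn⟩ ⟨-, rfl⟩
    refine ⟨m + n, ?_⟩
    rw [nmul_add]
    exact ele_trans (oplus_ele_oplus_right hm b) (oplus_ele_oplus_left hn _)

/-! ### Consequences of a unique maximal ideal -/

section Local

variable {I : Set M}

/-- Otherwise the ideal generated by `x` is proper and lies in a maximal ideal, which can only be
`I`. -/
theorem exists_nmul_eq_one (hI : ∀ J : Set M, IsMaximalIdeal J → J = I) (hx : x ∉ I) :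
    ∃ n, nmul n x = 1 := by
  by_contra! hne
  obtain ⟨J, hJ, hxJ⟩ := (isIdeal_principal x).exists_isMaximalIdeal (by
    rintro ⟨n, hn⟩
    exact hne n (ele_antisymm (ele_one _) hn))
  refine hx (hI J hJ ▸ hxJ ⟨1, ?_⟩)
  exact ele_oplus_left x _

/-- `y ⊖ x` is disjoint from `x ⊖ y`, hence from its multiple `1`, hence zero. This makes the
quotient by `I` totally ordered. -/
theorem ele_of_ominus_notMem (hI : ∀ J : Set M, IsMaximalIdeal J → J = I)
    (h : ominus x y ∉ I) : ELe y x := by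
  obtain ⟨n, hn⟩ := exists_nmul_eq_one hI h
  refine ele_of_ominus_eq_zero (eq_zero_of_ele_nmul (a := ominus y x) (b := ominus x y)
    (fun w h1 h2 => eq_zero_of_ele_ominus_ominus h2 h1) n (ele_refl _) ?_)
  rw [hn]
  exact ele_one _

end Local

/-! ### Quotient MV-algebras -/

section Quotient

theorem ominus_triangle (x y z : M) : ELe (ominus x z) (oplus (ominus x y) (ominus y z)) := by
  rw [ominus_ele_iff, oplus_comm (ominus x y), ← oplus_assoc]
  exact ele_trans (ele_oplus_ominus x y) (oplus_ele_oplus_right (ele_oplus_ominus y z) _)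

theorem ominus_oplus_ele (x y z : M) : ELe (ominus (oplus x z) (oplus y z)) (ominus x y) := by
  rw [ominus_ele_iff, oplus_assoc, oplus_comm z, ← oplus_assoc]
  exact oplus_ele_oplus_right (ele_oplus_ominus x y) z

/-- The congruence of an ideal of an MV-algebra. -/
def idealSetoid {I : Set M} (hI : IsIdeal I) : Setoid M where
  r x y := ominus x y ∈ I ∧ ominus y x ∈ I
  iseqv := by
    refine ⟨fun x => ?_, fun h => ⟨h.2, h.1⟩, fun {x y z} h h' => ⟨?_, ?_⟩⟩
    · rw [ominus_eq_zero (ele_refl x)]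
      exact ⟨hI.zero_mem, hI.zero_mem⟩
    · exact hI.mem_of_le (ominus_triangle x y z) (hI.oplus_mem h.1 h'.1)
    · exact hI.mem_of_le (ominus_triangle z y x) (hI.oplus_mem h'.2 h.2)

theorem idealSetoid_oplus_right {I : Set M} (hI : IsIdeal I) (h : idealSetoid hI x y) (z : M) :
    idealSetoid hI (oplus x z) (oplus y z) :=
  ⟨hI.mem_of_le (ominus_oplus_ele x y z) h.1, hI.mem_of_le (ominus_oplus_ele y x z) h.2⟩

/-- The quotient MV-algebra. -/
abbrev quotientMVAlgebra {I : Set M} (hI : IsIdeal I) : MVAlgebra (Quotient (idealSetoid hI)) where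
  zero := Quotient.mk _ 0
  one := Quotient.mk _ 1
  oplus := Quotient.map₂ oplus fun a b hab c d hcd =>
    (idealSetoid hI).trans (idealSetoid_oplus_right hI hab c) (by
      rw [oplus_comm b c, oplus_comm b d]
      exact idealSetoid_oplus_right hI hcd b)
  neg := Quotient.map neg fun a b hab => by
    refine ⟨?_, ?_⟩ <;> rw [ominus_neg_neg]
    exacts [hab.2, hab.1]
  oplus_assoc := by
    rintro ⟨x⟩ ⟨y⟩ ⟨z⟩
    exact congrArg (Quotient.mk _) (oplus_assoc x y z)
  oplus_comm := by
    rintro ⟨x⟩ ⟨y⟩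
    exact congrArg (Quotient.mk _) (oplus_comm x y)
  oplus_zero := by
    rintro ⟨x⟩
    exact congrArg (Quotient.mk _) (oplus_zero x)
  neg_neg := by
    rintro ⟨x⟩
    exact congrArg (Quotient.mk _) (neg_neg x)
  oplus_one := by
    rintro ⟨x⟩
    exact congrArg (Quotient.mk _) (oplus_one x)
  one_eq := congrArg (Quotient.mk _) one_eq
  oplus_neg_swap := by
    rintro ⟨x⟩ ⟨y⟩
    exact congrArg (Quotient.mk _) (oplus_neg_swap x y)

end Quotient

end MVAlgebra

/-! ### Real states by counting multiples -/

open Filter Topology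

namespace EffectAlgebra

open PartialSumAlgebra

section Multiples

variable {E : Type*} [EffectAlgebra E] {a b r r' w x y z : E} {k l : ℕ}

/-- `x = a + ⋯ + a + r` with `k` summands `a`. -/
def IsMulAdd (a : E) : ℕ → E → E → Prop
  | 0, r, x => r = x
  | k + 1, r, x => ∃ y, IsSum a y x ∧ IsMulAdd a k r y

theorem IsMulAdd.snoc (h : IsMulAdd a k r x) (hr : IsSum a w r) : IsMulAdd a (k + 1) w x := by
  induction k generalizing x with
  | zero =>
    obtain rfl : r = x := h
    exact ⟨w, hr, rfl⟩
  | succ k ih =>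
    obtain ⟨y, hy, h⟩ := h
    exact ⟨y, hy, ih h⟩

theorem IsMulAdd.le_of_not_ele (h : IsMulAdd a k r x) (h' : IsMulAdd a l r' x)
    (hr : ¬ ELe a r') : k ≤ l := by
  induction k generalizing x l with
  | zero => exact Nat.zero_le _
  | succ k ih =>
    obtain ⟨y, hy, h⟩ := h
    cases l with
    | zero =>
      obtain rfl : r' = x := h'
      exact absurd (ele_of_isSum_left hy) hr
    | succ l =>
      obtain ⟨y', hy', h'⟩ := h'
      obtain rfl := isSum_left_cancel hy hy'
      exact Nat.succ_le_succ (ih h h')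

theorem IsMulAdd.add (h : IsMulAdd a k r x) (h' : IsMulAdd a l r' y) (hxy : IsSum x y z) :
    ∃ w, IsSum r r' w ∧ IsMulAdd a (k + l) w z := by
  induction k generalizing x z with
  | zero =>
    obtain rfl : r = x := h
    rw [Nat.zero_add]
    induction l generalizing y z with
    | zero =>
      obtain rfl : r' = y := h'
      exact ⟨z, hxy, rfl⟩
    | succ l ih =>
      obtain ⟨y', hy', h'⟩ := h'
      obtain ⟨f, hf, haf⟩ := isSum_assoc.1 ⟨y, hy', isSum_comm.1 hxy⟩
      obtain ⟨w, hw, hwl⟩ := ih h' (isSum_comm.1 hf)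
      exact ⟨w, hw, f, haf, hwl⟩
  | succ k ih =>
    obtain ⟨x', hx', h⟩ := h
    obtain ⟨f, hf, haf⟩ := isSum_assoc.1 ⟨x, hx', hxy⟩
    obtain ⟨w, hw, hwl⟩ := ih h hf
    exact ⟨w, hw, by rw [Nat.succ_add]; exact ⟨f, haf, hwl⟩⟩

/-- Division with remainder: the bound on multiples of `a` stops the repeated subtraction. -/
theorem exists_isMulAdd_not_ele (ha : ∃ N, ∀ k r x, IsMulAdd a k r x → k ≤ N) (x : E) :
    ∃ k r, IsMulAdd a k r x ∧ ¬ ELe a r := by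
  by_contra! hne
  have hall : ∀ n, ∃ r, IsMulAdd a n r x := by
    intro n
    induction n with
    | zero => exact ⟨x, rfl⟩
    | succ n ih =>
      obtain ⟨r, hr⟩ := ih
      obtain ⟨w, hw⟩ := hne n r hr
      exact ⟨w, hr.snoc hw⟩
  obtain ⟨N, hN⟩ := ha
  obtain ⟨r, hr⟩ := hall (N + 1)
  exact absurd (hN _ _ _ hr) (by omega)

theorem IsMulAdd.double (hb : IsMulAdd b 2 w a) (h : IsMulAdd a k r x) :
    ∃ r', IsMulAdd b (2 * k) r' x := by
  induction k generalizing x with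
  | zero => exact ⟨x, rfl⟩
  | succ k ih =>
    obtain ⟨y, hy, h⟩ := h
    obtain ⟨r', hr'⟩ := ih h
    obtain ⟨v, -, hv⟩ := hb.add hr' hy
    exact ⟨v, by rw [show 2 * (k + 1) = 2 + 2 * k by ring]; exact hv⟩

end Multiples

/-- A totally ordered Archimedean effect algebra has a real-valued state. -/
theorem exists_real_state {E : Type*} [EffectAlgebra E] (htot : ∀ x y : E, ELe x y ∨ ELe y x)
    (harch : ∀ a : E, a ≠ 0 → ∃ N, ∀ k r x, IsMulAdd a k r x → k ≤ N) (h01 : (1 : E) ≠ 0) :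
    ∃ s : E → ℝ, (∀ x, 0 ≤ s x) ∧ s 1 = 1 ∧ ∀ x y z, IsSum x y z → s z = s x + s y := by
  -- `κ a x` is the integer part of `x / a` and `ρ a x` the remainder.
  choose κ ρ hκ hρ using fun a : {a : E // a ≠ 0} => exists_isMulAdd_not_ele (harch a.1 a.2)
  have hle : ∀ (a : {a : E // a ≠ 0}) {k r x}, IsMulAdd a.1 k r x → k ≤ κ a x := fun a _ _ x h =>
    h.le_of_not_ele (hκ a x) (hρ a x)
  have hsuper : ∀ (a : {a : E // a ≠ 0}) {x y z}, IsSum x y z → κ a x + κ a y ≤ κ a z := by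
    intro a x y z h
    obtain ⟨w, -, hw⟩ := (hκ a x).add (hκ a y) h
    exact hle a hw
  have hsub : ∀ (a : {a : E // a ≠ 0}) {x y z}, IsSum x y z → κ a z ≤ κ a x + κ a y + 1 := by
    intro a x y z h
    obtain ⟨w, hxy, hw⟩ := (hκ a x).add (hκ a y) h
    by_cases haw : ELe a.1 w
    -- Two remainders contain `a` at most once together: as `ρ a x ≤ a`, an `a` below `v` would also
    -- lie below `ρ a y`.
    · obtain ⟨v, hv⟩ := haw
      refine (hκ a z).le_of_not_ele (hw.snoc hv) fun hav => hρ a y ?_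
      obtain ⟨p, hp⟩ := (htot (ρ a x) a.1).resolve_right (hρ a x)
      obtain ⟨f, hf, hxf⟩ := isSum_assoc.1 ⟨a.1, hp, hv⟩
      obtain rfl := isSum_left_cancel hxf hxy
      exact ele_trans hav (ele_of_isSum_right hf)
    · exact ((hκ a z).le_of_not_ele hw haw).trans (Nat.le_succ _)
  have hone : ∀ a, 1 ≤ κ a 1 := fun a => hle a ⟨_, isSum_compl a.1, rfl⟩
  -- The defect of additivity of `κ a / κ a 1` can be made at most `1 / (n + 1)`. If a least nonzero
  -- element exists, its remainders vanish and there is no defect; otherwise halving makes `κ a 1`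
  -- arbitrarily large, while the defect of `κ a` is at most `1`.
  have hlarge : ∀ n : ℕ, ∃ a, ∀ x y z, IsSum x y z →
      (n + 1) * κ a z ≤ (n + 1) * κ a x + (n + 1) * κ a y + κ a 1 := by
    by_cases hatom : ∃ a : {a : E // a ≠ 0}, ∀ r : E, r ≠ 0 → ELe a.1 r
    · obtain ⟨a, ha⟩ := hatom
      have hρ0 : ∀ x, ρ a x = 0 := fun x => by
        by_contra h
        exact hρ a x (ha _ h)
      refine fun n => ⟨a, fun x y z h => ?_⟩
      obtain ⟨w, hxy, hw⟩ := (hκ a x).add (hκ a y) h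
      rw [hρ0, hρ0] at hxy
      obtain rfl := eq_of_isSum_zero hxy
      have h1 := (hκ a z).le_of_not_ele hw fun h => a.2 (eq_zero_of_ele_zero h)
      nlinarith
    · push Not at hatom
      have hhalf : ∀ a : {a : E // a ≠ 0}, ∃ b : {a : E // a ≠ 0}, 2 * κ a 1 ≤ κ b 1 := by
        intro a
        obtain ⟨r, hr, har⟩ := hatom a
        obtain ⟨p, hp⟩ := (htot r a.1).resolve_right har
        have hp0 : p ≠ 0 := by
          rintro rfl
          exact har (eq_of_isSum_zero hp ▸ ele_refl _)
        -- `b` is the smaller of the two parts `r` and `p` of `a`, so `2b ≤ a`.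
        obtain ⟨b, hb0, hbr, hbp⟩ : ∃ b, b ≠ 0 ∧ ELe b r ∧ ELe b p := by
          rcases htot r p with h | h
          exacts [⟨r, hr, ele_refl r, h⟩, ⟨p, hp0, h, ele_refl p⟩]
        obtain ⟨r', hr'⟩ := hbr
        obtain ⟨p', hp'⟩ := hbp
        obtain ⟨w, -, hw⟩ := IsMulAdd.add (a := b) (k := 1) (l := 1) ⟨r', hr', rfl⟩
          ⟨p', hp', rfl⟩ hp
        obtain ⟨v, hv⟩ := hw.double (hκ a 1)
        exact ⟨⟨b, hb0⟩, hle ⟨b, hb0⟩ hv⟩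
      have hunb : ∀ n : ℕ, ∃ a, n + 1 ≤ κ a 1 := by
        intro n
        induction n with
        | zero => exact ⟨⟨1, h01⟩, hone _⟩
        | succ n ih =>
          obtain ⟨a, ha⟩ := ih
          obtain ⟨b, hb⟩ := hhalf a
          exact ⟨b, by omega⟩
      intro n
      obtain ⟨a, ha⟩ := hunb n
      refine ⟨a, fun x y z h => ?_⟩
      have := hsub a h
      nlinarith
  choose a ha using hlarge
  let f : ℕ → E → ℝ := fun n x => κ (a n) x / κ (a n) 1
  have hpos : ∀ n, (0 : ℝ) < κ (a n) 1 := fun n => Nat.cast_pos.2 (hone _)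
  have hf : ∀ n x, f n x ∈ Set.Icc (0 : ℝ) 1 := by
    intro n x
    refine ⟨by positivity, (div_le_one (hpos n)).2 ?_⟩
    have := hsuper (a n) (isSum_compl x)
    exact_mod_cast (Nat.le_add_right _ _).trans this
  -- Compactness of `[0, 1]` gives a limit along an ultrafilter for all `x` simultaneously, with no
  -- convergence of the ratios required.
  have hlim : ∀ x, ∃ t ∈ Set.Icc (0 : ℝ) 1, Tendsto (fun n => f n x) (hyperfilter ℕ) (𝓝 t) := by
    intro x
    exact isCompact_Icc.ultrafilter_le_nhds ((hyperfilter ℕ).map fun n => f n x)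
      (le_principal_iff.2 (mem_map.2 (univ_mem' fun n => hf n x)))
  choose s hs0 hs using hlim
  refine ⟨s, fun x => (hs0 x).1, ?_, fun x y z h => ?_⟩
  · refine tendsto_nhds_unique (hs 1) ?_
    simp only [f, div_self (hpos _).ne']
    exact tendsto_const_nhds
  · have h1 : Tendsto (fun n => f n z - (f n x + f n y)) (hyperfilter ℕ) (𝓝 0) := by
      refine squeeze_zero (fun n => ?_) (fun n => ?_)
        ((tendsto_one_div_add_atTop_nhds_zero_nat (𝕜 := ℝ)).mono_left Nat.hyperfilter_le_atTop)
      · rw [sub_nonneg, ← add_div, div_le_div_iff_of_pos_right (hpos n)]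
        exact_mod_cast hsuper (a n) h
      · have h2 : ((n : ℝ) + 1) * κ (a n) z ≤
            (n + 1) * κ (a n) x + (n + 1) * κ (a n) y + κ (a n) 1 := by
          exact_mod_cast ha n x y z h
        have hn : (0 : ℝ) < n + 1 := by positivity
        rw [← add_div, ← sub_div, div_le_div_iff₀ (hpos n) hn]
        linarith
    exact sub_eq_zero.1 (tendsto_nhds_unique ((hs z).sub ((hs x).add (hs y))) h1)

end EffectAlgebra

/-! ### The splitting of a local MV-algebra -/

namespace MVAlgebra

open EffectAlgebra PartialSumAlgebra

variable {M : Type*} [MVAlgebra M] {I : Set M}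

theorem eq_oplus_of_isMulAdd {a r : M} {k : ℕ} : ∀ {x : M}, IsMulAdd a k r x →
    x = oplus (nmul k a) r := by
  induction k with
  | zero =>
    rintro x rfl
    rw [nmul, zero_oplus]
  | succ k ih =>
    rintro x ⟨y, hy, h⟩
    rw [hy.2, ih h, nmul, oplus_assoc]

/-- With more than `n` copies, removing one `a` still leaves `1`, so `a + 1` would be defined. -/
theorem le_of_isMulAdd_of_nmul_eq_one {a r x : M} {k n : ℕ} (ha : a ≠ 0) (hn : nmul n a = 1)
    (h : IsMulAdd a k r x) : k ≤ n := by
  by_contra hk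
  obtain ⟨m, rfl⟩ := Nat.exists_eq_add_of_lt (not_le.1 hk)
  obtain ⟨y, hy, h⟩ := h
  rw [eq_oplus_of_isMulAdd h, nmul_eq_one_of_le (Nat.le_add_right n m) hn, oplus_comm 1,
    oplus_one] at hy
  exact ha (eq_zero_of_isSum_one hy)

/-- An MV-algebra with a unique maximal ideal has a real-valued state that vanishes on that
ideal. -/
theorem exists_real_state_of_local (hmax : IsMaximalIdeal I)
    (hI : ∀ J : Set M, IsMaximalIdeal J → J = I) :
    ∃ s : M → ℝ, (∀ x, 0 ≤ s x) ∧ s 1 = 1 ∧ (∀ x y z, IsSum x y z → s z = s x + s y) ∧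
      ∀ x ∈ I, s x = 0 := by
  have hideal := hmax.isIdeal
  let _ : MVAlgebra (Quotient (idealSetoid hideal)) := quotientMVAlgebra hideal
  let π : M → Quotient (idealSetoid hideal) := Quotient.mk _
  have hzero : ∀ {x}, x ∈ I → π x = 0 := fun {x} hx => Quotient.sound
    ⟨hideal.mem_of_le (ominus_ele x 0) hx, by
      rw [ominus_eq_zero (zero_ele x)]; exact hideal.zero_mem⟩
  have hsum : ∀ {x y z}, IsSum x y z → IsSum (π x) (π y) (π z) := by
    rintro x y _ ⟨h, rfl⟩
    exact ⟨congrArg π h, rfl⟩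
  have hnmul : ∀ n x, nmul n (π x) = π (nmul n x) := by
    intro n x
    induction n with
    | zero => rfl
    | succ n ih => rw [nmul, ih]; rfl
  have h1 : (1 : M) ∉ I := fun h => hmax.ne_univ (hideal.eq_univ_iff.2 h)
  obtain ⟨s, hs0, hs1, hs⟩ := exists_real_state (E := Quotient (idealSetoid hideal)) (by
    rintro ⟨x⟩ ⟨y⟩
    by_cases h : ominus x y ∈ I
    · exact Or.inl (ele_of_ominus_eq_zero (hzero h))
    · obtain ⟨z, hz⟩ := ele_of_ominus_notMem hI h
      exact Or.inr ⟨_, hsum hz⟩) (by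
    rintro ⟨x⟩ hx
    obtain ⟨n, hn⟩ := exists_nmul_eq_one hI (fun h => hx (hzero h))
    refine ⟨n, fun k r y h => le_of_isMulAdd_of_nmul_eq_one hx ?_ h⟩
    exact (hnmul n x).trans (congrArg π hn)) (by
    intro h
    have h2 : ominus 1 0 ∈ I := (Quotient.exact h).1
    have h3 := ele_oplus_ominus (1 : M) 0
    rw [zero_oplus] at h3
    exact h1 (hideal.mem_of_le h3 h2))
  refine ⟨fun x => s (π x), fun x => hs0 _, hs1, fun x y z h => hs _ _ _ (hsum h),
    fun x hx => ?_⟩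
  show s (π x) = 0
  rw [hzero hx]
  exact left_eq_add.1 (hs _ _ _ (isSum_zero_left 0))

theorem exists_isSplitting_of_local (hmax : IsMaximalIdeal I)
    (hI : ∀ J : Set M, IsMaximalIdeal J → J = I) (hret : IsRetractive I) :
    ∃ (H : AddSubgroup ℝ) (h1 : (1 : ℝ) ∈ H) (s : M → H) (c : M → M),
      IsSplitting (⟨1, h1⟩ : H) s c := by
  obtain ⟨s, hs0, hs1, hs, hsI⟩ := exists_real_state_of_local hmax hI
  have hmono : ∀ {x y}, ELe x y → s x ≤ s y := by
    rintro x y ⟨z, hz⟩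
    rw [hs _ _ _ hz]
    exact le_add_of_nonneg_right (hs0 z)
  have hle1 : ∀ x, s x ≤ 1 := fun x => hs1 ▸ hmono (ele_one x)
  have hcompl : ∀ x, s (compl x) = 1 - s x := fun x => by
    rw [← hs1, hs _ _ _ (isSum_compl x), add_sub_cancel_left]
  have hsub : ∀ x y, s (oplus x y) ≤ s x + s y := by
    intro x y
    have h := isSum_oplus_ominus x (oplus x y)
    rw [oplus_ominus_of_mle (ele_iff_mle.1 (ele_oplus_left x y))] at h
    rw [hs _ _ _ h]
    exact add_le_add_right (hmono (ominus_ele_iff.2 (ele_refl _))) _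
  -- Subadditivity for `⊕` keeps all multiples of `x` at value `0`, whereas outside `I` some
  -- multiple is `1`.
  have hmem : ∀ {x}, s x = 0 → x ∈ I := by
    intro x hx
    by_contra hxI
    obtain ⟨n, hn⟩ := exists_nmul_eq_one hI hxI
    have h : ∀ n, s (nmul n x) ≤ 0 := by
      intro n
      induction n with
      | zero => exact (hsI 0 hmax.isIdeal.zero_mem).le
      | succ n ih => exact (hsub _ _).trans (by rw [hx, zero_add]; exact ih)
    have h' := h n
    rw [hn, hs1] at h'
    exact absurd h' (by norm_num)
  have hominus : ∀ {x y}, s x ≤ s y → ominus x y ∈ I := by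
    intro x y hxy
    by_contra h
    have h' := isSum_oplus_ominus y x
    rw [oplus_ominus_of_mle (ele_iff_mle.1 (ele_of_ominus_notMem hI h))] at h'
    have h2 := hs _ _ _ h'
    exact h (hmem (le_antisymm (by linarith) (hs0 _)))
  have hmeet : ∀ {x y}, s x ≤ s y → s (meet x y) = s x := by
    intro x y hxy
    rw [hs _ _ _ (isSum_meet_ominus x y), hsI _ (hominus hxy), add_zero]
  -- `s x + s y ≤ 1` need not make `x + y` defined; replacing `x` by `x ∧ y⁻` does, without changing
  -- the value.
  have hadd : ∀ {x y}, s x + s y ≤ 1 → ∃ x' z, s x' = s x ∧ IsSum x' y z := by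
    intro x y hxy
    obtain ⟨z, hz⟩ := exists_isSum_iff.2 (show ELe (meet x (compl y)) (compl y) from
      ele_of_isSum_left (isSum_meet_ominus' x (compl y)))
    exact ⟨_, z, hmeet (by rw [hcompl]; linarith), hz⟩
  let H : AddSubgroup ℝ :=
    { carrier := {t | ∃ (n : ℤ) (x : M), t = n + s x}
      zero_mem' := ⟨0, 0, by rw [hsI 0 hmax.isIdeal.zero_mem]; simp⟩
      add_mem' := by
        rintro _ _ ⟨n, x, rfl⟩ ⟨m, y, rfl⟩
        rcases le_total (s x + s y) 1 with h | h
        · obtain ⟨x', z, hx', hz⟩ := hadd h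
          refine ⟨n + m, z, ?_⟩
          rw [hs _ _ _ hz, hx']; push_cast; ring
        -- Carry: `s x + s y - 1` is the value of the complement of a sum of complements.
        · obtain ⟨x', z, hx', hz⟩ := hadd (x := compl x) (y := compl y) (by
            rw [hcompl, hcompl]; linarith)
          refine ⟨n + m + 1, compl z, ?_⟩
          rw [hcompl, hs _ _ _ hz, hx', hcompl, hcompl]; push_cast; ring
      neg_mem' := by
        rintro _ ⟨n, x, rfl⟩
        refine ⟨-n - 1, compl x, ?_⟩
        rw [hcompl]; push_cast; ring }
  have hH : ∀ x, s x ∈ H := fun x => ⟨0, x, by simp⟩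
  obtain ⟨δ, hδ, hδ'⟩ := hret
  have hcongr : ∀ {x y}, s x = s y → IdealQuot.mk I x = IdealQuot.mk I y := by
    intro x y hxy
    exact Quot.sound ⟨_, hominus hxy.le, _, hominus hxy.ge, _,
      isSum_comm.1 (isSum_meet_ominus x y), isSum_comm.1 (isSum_meet_ominus' x y)⟩
  refine ⟨H, hs1 ▸ hH 1, fun x => ⟨s x, hH x⟩, fun x => δ (IdealQuot.mk I x),
    ⟨?_, hs0, ?_, ?_, ?_, ?_, ?_, ?_, ?_, ?_, ?_⟩⟩
  · exact zero_lt_one' ℝ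
  · rintro ⟨t, n, x, rfl⟩ h0 h1
    have h0 : 0 ≤ (n : ℝ) + s x := h0
    have h1 : (n : ℝ) + s x ≤ 1 := h1
    have hx0 := hs0 x
    have hx1 := hle1 x
    have hn1 : n ≤ 1 := by exact_mod_cast (show (n : ℝ) ≤ 1 by linarith)
    have hn2 : -1 ≤ n := by exact_mod_cast (show (-1 : ℝ) ≤ n by linarith)
    -- The cases `n = -1` and `n = 1` are boundary cases: they force the value `0` or `1`.
    obtain rfl | rfl | rfl : n = -1 ∨ n = 0 ∨ n = 1 := by omega
    · refine ⟨0, Subtype.ext ?_⟩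
      show s 0 = _
      rw [hsI 0 hmax.isIdeal.zero_mem]
      push_cast at *; linarith
    · exact ⟨x, Subtype.ext (by simp)⟩
    · refine ⟨1, Subtype.ext ?_⟩
      show s 1 = _
      rw [hs1]
      push_cast at *; linarith
  · exact Subtype.ext hs1
  · intro x y z h
    exact Subtype.ext (hs x y z h)
  · intro x y hxy
    have hxy : s x < s y := hxy
    refine ele_of_ominus_notMem hI fun h => hxy.not_ge ?_
    have h1 := (hmono (ele_oplus_ominus y x)).trans (hsub _ _)
    rwa [hsI _ h, add_zero] at h1
  · intro x y hxy
    have hxy : s x = s y := congrArg Subtype.val hxy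
    exact ⟨meet x y, Subtype.ext (hmeet hxy.le), ele_of_isSum_left (isSum_meet_ominus x y),
      ele_of_isSum_left (isSum_meet_ominus' x y)⟩
  · intro x y hxy
    exact congrArg δ (hcongr (congrArg Subtype.val hxy))
  · intro x
    have hrel : ∀ a b, IdealRel I a b → s a = s b := by
      rintro a b ⟨e, he, f, hf, d, h, h'⟩
      rw [hs _ _ _ h, hs _ _ _ h', hsI e he, hsI f hf]
    exact Subtype.ext (congrArg (Quot.lift s hrel) (hδ' (IdealQuot.mk I x)))
  · intro x y z hz
    have hz : s z = s x + s y := congrArg Subtype.val hz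
    -- The classes modulo `I` depend only on `s`, so `x' + y = z'` witnesses a sum of the classes of
    -- `x` and `y`, which `δ` preserves.
    obtain ⟨x', z', hx', hz'⟩ := hadd (hz ▸ hle1 z)
    rw [hcongr hx'.symm, hcongr (x := z) (y := z') (by rw [hs _ _ _ hz', hx', hz])]
    exact hδ.map_isSum ⟨x', y, z', hz', rfl, rfl, rfl⟩
  · exact hδ.map_one

end MVAlgebra

theorem theorem6p4 (E : Type w) [MVAlgebra E] :
    List.TFAE [
      EffectAlgebra.IsLocal E ∧ EffectAlgebra.IsRetractive (EffectAlgebra.Rad E),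
      ∃ (H : AddSubgroup ℝ) (h1 : (1 : ℝ) ∈ H),
        EffectAlgebra.IsStrongPerfect E (⟨1, h1⟩ : H) (subgroup_one_nonneg H h1),
      ∃ (H : AddSubgroup ℝ) (h1 : (1 : ℝ) ∈ H)
        (G : Type w) (_ : AddCommGroup G) (_ : Lattice G) (_ : IsOrderedAddMonoid G),
        EffectAlgebra.Isomorphic E
          (PoGamma (toLex ((⟨1, h1⟩ : H), (0 : G))) (lex_unit_nonneg (subgroup_one_nonneg H h1)))] := by
  tfae_have 1 → 2 := by
    rintro ⟨⟨I, hmax, hI⟩, hret⟩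
    rw [hmax.rad_eq hI] at hret
    obtain ⟨H, h1, s, c, h⟩ := MVAlgebra.exists_isSplitting_of_local hmax hI hret
    exact ⟨H, h1, h.isStrongPerfect (MVAlgebra.rdp E) _⟩
  tfae_have 2 → 3 := by
    rintro ⟨H, h1, h⟩
    obtain ⟨s, c, h⟩ := EffectAlgebra.IsStrongPerfect.exists_isSplitting
      (show (0 : H) < ⟨1, h1⟩ from zero_lt_one' ℝ) h
    obtain ⟨G, i1, i2, i3, φ, hφ⟩ := h.exists_lex_isIntervalRep MVAlgebra.exists_isLUB
    exact ⟨H, h1, G, i1, i2, i3, (EffectAlgebra.isomorphic_poGamma_iff _).2 ⟨φ, hφ⟩⟩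
  tfae_have 3 → 1 := by
    rintro ⟨H, h1, G, i1, i2, i3, h⟩
    obtain ⟨φ, hφ⟩ := (EffectAlgebra.isomorphic_poGamma_iff _).1 h
    exact hφ.isLocal_and_isRetractive_rad (show (0 : H) < ⟨1, h1⟩ from zero_lt_one' ℝ)
  tfae_finish
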